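/- **Model.** Let $N\ge 2$ and let $a,b,c>0$ with $b>c$, and let $0<P_{\min}\le \frac{a}{2b-c}<P_{\max}\le \frac ab$, $\sigma_{\mathrm{env}}\in\mathbb R$. For $x\in\mathbb R^N$ write $\bar x_{-i}=\frac1{N-1}\sum_{j\ne i}x_j$. Let $\mathcal D_{\exp}$ be a probability law on $\mathbb R^N$ with independent coordinates, supported on $[P_{\min},P_{\max}]^N$, with mean $\mu$ and (diagonal) covariance matrix $\Sigma_{\exp}$ whose diagonal entries are positive. An *explore-then-exploit process* with horizons $(K,T)$ consists of random prices $P_{i,t}$, quantities $Q_{i,t}$ and square-integrable demand shocks $\varepsilon_{i,t}$ ($1\le i\le N$, $1\le t\le K+T$) on a probability space such that, with $P_t=(P_{1,t},\dots,P_{N,t})$ and $\mathcal F_t=\sigma(P_{j,s},Q_{j,s}:j\le N,\,1\le s\le t)$: * $Q_{i,t}=a-bP_{i,t}+\frac{c}{N-1}\sum_{j\ne i}P_{j,t}+\varepsilon_{i,t}$ and $Q_{i,t}>0$ almost surely; * $\mathbb E[\varepsilon_{i,t+1}\mid\mathcal F_t]=0$ and $\mathbb E[\varepsilon_{i,t+1}^2\mid\mathcal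 F_t]\le\sigma_{\mathrm{env}}^2$ for $0\le t<K+T$, and, in the exploration phase, $\mathbb E[P_{i,t+1}\varepsilon_{i,t+1}\mid\mathcal F_t]=0$ for $0\le t<K$; * $P_1,\dots,P_K$ are i.i.d. with law $\mathcal D_{\exp}$; * for $K\le t<K+T$, almost surely, $P_{i,t+1}$ maximizes $p(\hat\alpha_{i,t}+\hat\beta_{i,t}p)$ over $p\in[P_{\min},P_{\max}]$, where $(\hat\alpha_{i,t},\hat\beta_{i,t})$ are ordinary least squares estimates, i.e. minimize $\sum_{s=1}^t(Q_{i,s}-\alpha-\beta P_{i,s})^2$ over $(\alpha,\beta)\in\mathbb R^2$. **Price-moments ODE.** For $U\in\mathbb R^N$ and $V\in\mathbb R^{N\times N}$, with $\bar V_{i,-i}=\frac1{N-1}\sum_{j\ne i}V_{ij}$, let $\pi(U,V)\in\mathbb R^N$ be given by $$\pi_i(U,V)=\min\Bigl\{\max\Bigl\{\frac{(a+c\,\bar U_{-i})V_{ii}-c\,U_i\bar V_{i,-i}}{2(bV_{ii}-c\bar V_{i,-i})},\,P_{\min}\Bigr\},\,P_{\max}\Bigr\}\quad\text{if }-bV_{ii}+c\bar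 V_{i,-i}<0,$$ and $\pi_i(U,V)=P_{\max}$ otherwise. The price-moments ODE is the system on $[1,\infty)$ $$\dot U(s)=\frac{P(s)-U(s)}{s},\qquad \dot V(s)=(P(s)-U(s))(P(s)-U(s))^\top,\qquad P(s)=\pi(U(s),V(s)),$$ with $U(1)=\mu$, $V(1)=\Sigma_{\exp}$. **Theorem.** The price-moments ODE has a unique solution $(U,V)$ on $[1,\infty)$; write $P^{\mathrm{ODE}}(s;\mu,\Sigma_{\exp})=\pi(U(s),V(s))$. Let $K_m\to\infty$, $T_m\to\infty$ be sequences of natural numbers with $(K_m+T_m)/K_m\to\tau\in[1,\infty)$, and for every $m$ let there be given an explore-then-exploit process with horizons $(K_m,T_m)$ (with the same $N,a,b,c,P_{\min},P_{\max},\sigma_{\mathrm{env}},\mathcal D_{\exp}$ for all $m$; the probability spaces may depend on $m$). Then $$(P_{1,K_m+T_m},\dots,P_{N,K_m+T_m})\xrightarrow{\ \mathbb P\ }P^{\mathrm{ODE}}(\tau;\mu,\Sigma_{\exp})\qquad(m\to\infty).$$ -/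

import Mathlib

open MeasureTheory ProbabilityTheory Filter Topology

noncomputable section

/-- The deterministic parameters of the market: demand coefficients `a`, `b`, `c`, the price
interval `[pMin, pMax]` and the bound `σenv` on the conditional standard deviation of the demand
shocks, with the standing inequalities. The number `a / (2 * b - c)` is the Nash price. -/
structure Market where
  a : ℝ
  b : ℝ
  c : ℝ
  pMin : ℝ
  pMax : ℝ
  σenv : ℝ
  a_pos : 0 < a
  b_pos : 0 < b
  c_pos : 0 < c
  c_lt_b : c < b
  pMin_pos : 0 < pMin
  pMin_le_nash : pMin ≤ a / (2 * b - c)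
  nash_lt_pMax : a / (2 * b - c) < pMax
  pMax_le : pMax ≤ a / b

/-- The average of the coordinates of `x` other than the `i`-th one. -/
def othersMean {N : ℕ} (x : Fin N → ℝ) (i : Fin N) : ℝ :=
  (∑ j ∈ Finset.univ.erase i, x j) / ((N : ℝ) - 1)

/-- Expected demand of firm `i` at the price vector `p`. -/
def expectedDemand {N : ℕ} (M : Market) (p : Fin N → ℝ) (i : Fin N) : ℝ :=
  M.a - M.b * p i + M.c * othersMean p i

/-- The exploration law `D` on price vectors: independent coordinates, support in the box
`[pMin, pMax]^N`, and positive variance of every coordinate. -/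
structure IsExplorationLaw {N : ℕ} (M : Market) (D : Measure (Fin N → ℝ)) : Prop where
  isProbabilityMeasure : IsProbabilityMeasure D
  indep : iIndepFun (fun (i : Fin N) (x : Fin N → ℝ) => x i) D
  support : ∀ᵐ x ∂D, ∀ i, x i ∈ Set.Icc M.pMin M.pMax
  variance_pos : ∀ i, 0 < variance (fun x : Fin N → ℝ => x i) D

/-- The mean vector of the exploration law. -/
def explorationMean {N : ℕ} (D : Measure (Fin N → ℝ)) : Fin N → ℝ :=
  fun i => ∫ x, x i ∂D

/-- The covariance matrix of the exploration law. -/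
def explorationCov {N : ℕ} (D : Measure (Fin N → ℝ)) : Matrix (Fin N) (Fin N) ℝ :=
  Matrix.of fun i j => covariance (fun x : Fin N → ℝ => x i) (fun x : Fin N → ℝ => x j) D

/-- `(α, β)` are ordinary least squares estimates in the regression of `q s` on `(1, p s)` over
the periods `s = 1, …, t`. They are unique as soon as the `p s` are not all equal. -/
def IsOLSFit (p q : ℕ → ℝ) (t : ℕ) (α β : ℝ) : Prop :=
  ∀ α' β' : ℝ,
    ∑ s ∈ Finset.Icc 1 t, (q s - (α + β * p s)) ^ 2 ≤
      ∑ s ∈ Finset.Icc 1 t, (q s - (α' + β' * p s)) ^ 2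

/-- The σ-algebra generated by all prices and quantities of the periods `1, …, t`. -/
abbrev history {N : ℕ} {Ω : Type*} (P Q : ℕ → Fin N → Ω → ℝ) (t : ℕ) : MeasurableSpace Ω :=
  ⨆ s ∈ Finset.Icc 1 t, ⨆ i : Fin N,
    MeasurableSpace.comap (P s i) inferInstance ⊔ MeasurableSpace.comap (Q s i) inferInstance

/-- Prices `P t i`, quantities `Q t i` and demand shocks `ε t i` (period `t`, firm `i`) form an
explore-then-exploit process with `K` exploration periods `1, …, K` and `T` exploitation periods
`K + 1, …, K + T`. -/
structure IsPricingProcess {N : ℕ} {Ω : Type*} [MeasurableSpace Ω] (M : Market)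
    (D : Measure (Fin N → ℝ)) (K T : ℕ) (Pr : Measure Ω)
    (P Q ε : ℕ → Fin N → Ω → ℝ) : Prop where
  measurable_price : ∀ t ∈ Finset.Icc 1 (K + T), ∀ i, Measurable (P t i)
  measurable_quantity : ∀ t ∈ Finset.Icc 1 (K + T), ∀ i, Measurable (Q t i)
  /-- The true linear demand system. -/
  demand : ∀ t ∈ Finset.Icc 1 (K + T), ∀ i ω,
    Q t i ω = expectedDemand M (fun j => P t j ω) i + ε t i ω
  /-- Realized sales are positive. -/
  quantity_pos : ∀ t ∈ Finset.Icc 1 (K + T), ∀ i, ∀ᵐ ω ∂Pr, 0 < Q t i ω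
  /-- The shocks are square integrable, so that the conditional expectations below are genuine. -/
  shock_memLp : ∀ t ∈ Finset.Icc 1 (K + T), ∀ i, MemLp (ε t i) 2 Pr
  /-- The shocks are martingale differences with respect to the history. -/
  shock_mean : ∀ t < K + T, ∀ i, Pr[ε (t + 1) i | history P Q t] =ᵐ[Pr] 0
  /-- The conditional second moments of the shocks are uniformly bounded. -/
  shock_sq : ∀ t < K + T, ∀ i,
    Pr[fun ω => ε (t + 1) i ω ^ 2 | history P Q t] ≤ᵐ[Pr] fun _ => M.σenv ^ 2
  /-- Exploration prices are exogenous: given the past, the randomized price of a firm is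
  uncorrelated with its demand shock of the same period. (In exploitation periods this holds
  automatically, since the posted price is a function of the past.) -/
  shock_exogenous : ∀ t < K, ∀ i,
    Pr[fun ω => P (t + 1) i ω * ε (t + 1) i ω | history P Q t] =ᵐ[Pr] 0
  /-- In the exploration phase the price vectors are independent with common law `D`. -/
  explore_indep :
    iIndepFun (fun (t : Finset.Icc 1 K) (ω : Ω) (i : Fin N) => P (t : ℕ) i ω) Pr
  explore_law : ∀ t ∈ Finset.Icc 1 K, Pr.map (fun ω i => P t i ω) = D
  /-- In the exploitation phase each firm fits a linear demand curve `α + β p` to its own history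
  by least squares and posts a maximizer of the predicted profit over `[pMin, pMax]`. -/
  exploit : ∀ t, K ≤ t → t < K + T → ∀ i, ∀ᵐ ω ∂Pr, ∃ α β : ℝ,
    IsOLSFit (fun s => P s i ω) (fun s => Q s i ω) t α β ∧
    P (t + 1) i ω ∈ Set.Icc M.pMin M.pMax ∧
    IsMaxOn (fun p : ℝ => p * (α + β * p)) (Set.Icc M.pMin M.pMax) (P (t + 1) i ω)

/-- The posted-price map of the price-moments ODE. Here `othersMean U i` is `Ū₋ᵢ` and
`othersMean (V i) i` is `V̄ᵢ,₋ᵢ`. -/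
def postedPrice {N : ℕ} (M : Market) (U : Fin N → ℝ) (V : Matrix (Fin N) (Fin N) ℝ) :
    Fin N → ℝ := fun i =>
  if -M.b * V i i + M.c * othersMean (V i) i < 0 then
    min (max
      (((M.a + M.c * othersMean U i) * V i i - M.c * U i * othersMean (V i) i) /
        (2 * (M.b * V i i - M.c * othersMean (V i) i))) M.pMin) M.pMax
  else M.pMax

/-- `(U, V)` solves the price-moments ODE on `[1, ∞)` with `U 1 = μ`, `V 1 = S`. At time `1` the
derivative is one-sided; the values of `U`, `V` at times below `1` are irrelevant. -/
structure IsPriceMomentsSolution {N : ℕ} (M : Market) (μ : Fin N → ℝ)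
    (S : Matrix (Fin N) (Fin N) ℝ) (U : ℝ → Fin N → ℝ)
    (V : ℝ → Matrix (Fin N) (Fin N) ℝ) : Prop where
  init_U : U 1 = μ
  init_V : V 1 = S
  deriv_U : ∀ s : ℝ, 1 ≤ s → ∀ i,
    HasDerivWithinAt (fun r => U r i)
      ((postedPrice M (U s) (V s) i - U s i) / s) (Set.Ici 1) s
  deriv_V : ∀ s : ℝ, 1 ≤ s → ∀ i j,
    HasDerivWithinAt (fun r => V r i j)
      ((postedPrice M (U s) (V s) i - U s i) * (postedPrice M (U s) (V s) j - U s j))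
      (Set.Ici 1) s

end

/-! Measure time in units of the exploration length, s = t / K, and record the history through the
average prices and the centered price products divided by K (`empMoments`). By Welford's recursion
(`coMoment_succ`) this state follows, up to errors of order 1 / K², an Euler scheme with step 1 / K
for the price-moments ODE, provided that each posted price is close to the price map at the current
state (`norm_empMoments_step_le`).

That closeness comes from the normal equations. The fitted line passes through the point of means,
and its slope times the price variance is an empirical covariance. Inserting the true demand turns
both into functions of the state plus normalized sums of the shocks ε and of price times ε
(`avg_quantity_eq`, `sum_centered_mul_quantity_eq`). These are martingale sums with second moment
O(t), so after division by K they are O(K^(-1/2)) in L¹ while t / K stays bounded.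

The price map has to be Lipschitz, although it divides by an estimated slope that may vanish or
change sign. Predicted demand is bounded below by a positive constant at feasible mean prices. Hence
a nearly flat demand curve puts the unconstrained optimum above `pMax`, where the price is clipped
anyway. On the region of feasible mean prices and variances at least v, the map therefore agrees
with a globally Lipschitz one (`Market.bestPrice_eq_regPrice`, `Market.postedPrice_eq_regPosted`).
Both the ODE and, with high probability, the process stay in this region: mean prices are trapped in
the price interval, and diagonal second moments never decrease. This gives well-posedness of the ODE
(`exists_isPriceMomentsSolution`, `IsPriceMomentsSolution.unique`).

A discrete Grönwall argument (`exists_price_deviation_bound`) bounds the final deviation by the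
initial error, the time average of the shock errors, the last shock error and 1 / K. Only an average
over time enters, so L¹ bounds at single times suffice and no maximal inequality is needed. The law
of large numbers handles the initial error, and Markov's inequality concludes. -/

noncomputable section

/-! ### The price map of a single firm -/

/-- Projection onto the price interval. -/
def Market.clip (M : Market) (t : ℝ) : ℝ := min (max t M.pMin) M.pMax

/-- The price chosen by a firm with mean price `u`, predicted demand `d` at `u`, price variance `w`
and estimated demand slope `-x / w`. -/
def Market.bestPrice (M : Market) (u d w x : ℝ) : ℝ :=
  if 0 < x then M.clip (u / 2 + d * w / (2 * x)) else M.pMax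

/-- A globally Lipschitz version of `Market.bestPrice`. -/
def Market.regPrice (M : Market) (x₀ u d w x : ℝ) : ℝ :=
  M.clip (u / 2 + min (d * w / max x x₀) (2 * M.pMax) / 2)

namespace Market

variable (M : Market)

lemma pMin_lt_pMax : M.pMin < M.pMax := M.pMin_le_nash.trans_lt M.nash_lt_pMax

lemma pMax_pos : 0 < M.pMax := M.pMin_pos.trans M.pMin_lt_pMax

lemma b_mul_pMax_le : M.b * M.pMax ≤ M.a := by
  have := (le_div_iff₀ M.b_pos).1 M.pMax_le
  linarith

lemma pMin_le_clip (t : ℝ) : M.pMin ≤ M.clip t :=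
  le_min (le_max_right _ _) M.pMin_lt_pMax.le

lemma clip_le_pMax (t : ℝ) : M.clip t ≤ M.pMax := min_le_right _ _

lemma clip_mem (t : ℝ) : M.clip t ∈ Set.Icc M.pMin M.pMax := ⟨M.pMin_le_clip t, M.clip_le_pMax t⟩

lemma clip_of_mem {t : ℝ} (ht : t ∈ Set.Icc M.pMin M.pMax) : M.clip t = t := by
  rw [clip, max_eq_left ht.1, min_eq_left ht.2]

lemma clip_of_ge {t : ℝ} (ht : M.pMax ≤ t) : M.clip t = M.pMax :=
  min_eq_right (ht.trans (le_max_left _ _))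

lemma abs_clip_sub_clip_le (s t : ℝ) : |M.clip s - M.clip t| ≤ |s - t| := by
  unfold clip
  refine (abs_min_sub_min_le_max _ _ _ _).trans (max_le (abs_max_sub_max_le_abs _ _ _) ?_)
  simp

lemma measurable_clip : Measurable M.clip :=
  (measurable_id.max measurable_const).min measurable_const

lemma bestPrice_mem (u d w x : ℝ) : M.bestPrice u d w x ∈ Set.Icc M.pMin M.pMax := by
  unfold bestPrice
  split_ifs
  · exact M.clip_mem _
  · exact ⟨M.pMin_lt_pMax.le, le_rfl⟩

lemma regPrice_mem (x₀ u d w x : ℝ) : M.regPrice x₀ u d w x ∈ Set.Icc M.pMin M.pMax :=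
  M.clip_mem _

/-- The threshold `x₀` is the value at which `δ * v / x₀ = 2 * pMax`. For smaller positive x the
vertex of the profit parabola already exceeds `pMax`, so the truncations act only where the clip
returns `pMax`, which is also the value for x ≤ 0. -/
lemma bestPrice_eq_regPrice {u d w x δ v x₀ : ℝ} (hu : 0 ≤ u) (hδ : 0 < δ) (hd : δ ≤ d)
    (hv : 0 < v) (hw : v ≤ w) (hx₀ : x₀ = δ * v / (2 * M.pMax)) :
    M.bestPrice u d w x = M.regPrice x₀ u d w x := by
  have hp := M.pMax_pos
  have hx₀pos : 0 < x₀ := by rw [hx₀]; positivity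
  have key : ∀ y, 0 < y → y ≤ x₀ → 2 * M.pMax ≤ d * w / y := by
    intro y hy hyx
    rw [le_div_iff₀ hy]
    calc 2 * M.pMax * y ≤ 2 * M.pMax * x₀ := by gcongr
      _ = δ * v := by rw [hx₀]; field_simp
      _ ≤ d * w := by gcongr; exact hδ.le.trans hd
  unfold bestPrice regPrice
  rcases le_or_gt x x₀ with h | h
  · rw [max_eq_right h, min_eq_right (key x₀ hx₀pos le_rfl),
      M.clip_of_ge (t := u / 2 + 2 * M.pMax / 2) (by linarith)]
    split_ifs with hx
    · apply M.clip_of_ge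
      have := key x hx h
      have e : d * w / (2 * x) = d * w / x / 2 := by field_simp
      rw [e]; linarith
    · rfl
  · have hx : 0 < x := hx₀pos.trans h
    rw [max_eq_left h.le, if_pos hx]
    have e : d * w / (2 * x) = d * w / x / 2 := by field_simp
    rw [e]
    rcases le_total (d * w / x) (2 * M.pMax) with h' | h'
    · rw [min_eq_left h']
    · rw [min_eq_right h', M.clip_of_ge (by linarith), M.clip_of_ge (by linarith)]

end Market

/-- The truncation at C replaces an upper bound on w: unless the unprimed quotient exceeds C, when
the difference is nonpositive, one has w / B ≤ C / δ. The four summands of the constant bound the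
four terms of the expansion around the unprimed point. -/
lemma min_div_sub_min_div_le {d d' w w' B B' δ D x C : ℝ} (hδ : 0 < δ) (hd : δ ≤ d) (hdD : d ≤ D)
    (hd' : δ ≤ d') (hd'D : d' ≤ D) (hw : 0 ≤ w) (hx : 0 < x) (hB : x ≤ B)
    (hB' : x ≤ B') (hC : 0 ≤ C) :
    min (d' * w' / B') C - min (d * w / B) C ≤
      (D / x + C / δ + D * C / (δ * x) + C / x) * (|d' - d| + |w' - w| + |B' - B|) := by
  have hBp : 0 < B := hx.trans_le hB
  have hBp' : 0 < B' := hx.trans_le hB'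
  have hdp : 0 < d := hδ.trans_le hd
  have hDp : 0 < D := hdp.trans_le hdD
  rcases le_total C (d * w / B) with h | h
  · rw [min_eq_right h]
    have : min (d' * w' / B') C - C ≤ 0 := by linarith [min_le_right (d' * w' / B') C]
    exact this.trans (by positivity)
  rw [min_eq_left h]
  have hr : w / B ≤ C / δ := by
    rw [le_div_iff₀ hδ]
    calc w / B * δ ≤ w / B * d := by gcongr
      _ = d * w / B := by ring
      _ ≤ C := h
  have hr0 : 0 ≤ w / B := by positivity
  have hid : d' * w' / B' - d * w / B =
      d' * (w' - w) / B' + (d' - d) * (w / B) + (d' - d) * (w / B) * ((B - B') / B')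
        + d * w / B * ((B - B') / B') := by
    field_simp
    ring
  have hΔ : |d' - d| ≤ D := by rw [abs_le]; constructor <;> linarith
  have hBB : |(B - B') / B'| ≤ |B' - B| / x := by
    rw [abs_div, abs_of_pos hBp', abs_sub_comm]
    gcongr
  have t1 : d' * (w' - w) / B' ≤ D / x * |w' - w| := by
    calc d' * (w' - w) / B' ≤ D * |w' - w| / x := by
          have h1 : d' * (w' - w) ≤ D * |w' - w| := by
            calc d' * (w' - w) ≤ d' * |w' - w| := by
                  gcongr
                  exacts [hδ.le.trans hd', le_abs_self _]
              _ ≤ _ := by gcongr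
          calc _ ≤ D * |w' - w| / B' := by gcongr
            _ ≤ _ := by gcongr
      _ = _ := by ring
  have t2 : (d' - d) * (w / B) ≤ C / δ * |d' - d| := by
    calc (d' - d) * (w / B) ≤ |d' - d| * (w / B) := by gcongr; exact le_abs_self _
      _ ≤ |d' - d| * (C / δ) := by gcongr
      _ = _ := by ring
  have t3 : (d' - d) * (w / B) * ((B - B') / B') ≤ D * C / (δ * x) * |B' - B| := by
    calc (d' - d) * (w / B) * ((B - B') / B') ≤ |(d' - d) * (w / B) * ((B - B') / B')| :=
          le_abs_self _
      _ = |d' - d| * (w / B) * |(B - B') / B'| := by rw [abs_mul, abs_mul, abs_of_nonneg hr0]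
      _ ≤ D * (C / δ) * (|B' - B| / x) := by gcongr
      _ = _ := by field_simp
  have t4 : d * w / B * ((B - B') / B') ≤ C / x * |B' - B| := by
    calc d * w / B * ((B - B') / B') ≤ |d * w / B * ((B - B') / B')| := le_abs_self _
      _ = d * w / B * |(B - B') / B'| := by rw [abs_mul, abs_of_nonneg (by positivity)]
      _ ≤ C * (|B' - B| / x) := by gcongr
      _ = _ := by ring
  have e1 : 0 ≤ D / x := by positivity
  have e2 : 0 ≤ C / δ := by positivity
  have e3 : 0 ≤ D * C / (δ * x) := by positivity
  have e4 : 0 ≤ C / x := by positivity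
  have a1 := abs_nonneg (d' - d)
  have a2 := abs_nonneg (w' - w)
  have a3 := abs_nonneg (B' - B)
  have hmin := min_le_left (d' * w' / B') C
  nlinarith [mul_nonneg e1 a1, mul_nonneg e1 a3, mul_nonneg e2 a2, mul_nonneg e2 a3,
    mul_nonneg e3 a1, mul_nonneg e3 a2, mul_nonneg e4 a1, mul_nonneg e4 a2]

lemma abs_min_div_sub_min_div_le {d d' w w' B B' δ D x C : ℝ} (hδ : 0 < δ) (hd : δ ≤ d)
    (hdD : d ≤ D) (hd' : δ ≤ d') (hd'D : d' ≤ D) (hw : 0 ≤ w) (hw' : 0 ≤ w') (hx : 0 < x)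
    (hB : x ≤ B) (hB' : x ≤ B') (hC : 0 ≤ C) :
    |min (d * w / B) C - min (d' * w' / B') C| ≤
      (D / x + C / δ + D * C / (δ * x) + C / x) * (|d - d'| + |w - w'| + |B - B'|) := by
  rw [abs_le']
  refine ⟨min_div_sub_min_div_le hδ hd' hd'D hd hdD hw' hx hB' hB hC, ?_⟩
  rw [neg_sub, abs_sub_comm d, abs_sub_comm w, abs_sub_comm B]
  exact min_div_sub_min_div_le hδ hd hdD hd' hd'D hw hx hB hB' hC

lemma Market.exists_regPrice_lipschitz (M : Market) {δ D x₀ : ℝ} (hδ : 0 < δ) (hD : δ ≤ D)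
    (hx₀ : 0 < x₀) :
    ∃ L : ℝ, 0 ≤ L ∧ ∀ u u' d d' w w' x x' : ℝ, δ ≤ d → d ≤ D → δ ≤ d' → d' ≤ D → 0 ≤ w →
      0 ≤ w' → |M.regPrice x₀ u d w x - M.regPrice x₀ u' d' w' x'| ≤
        L * (|u - u'| + |d - d'| + |w - w'| + |x - x'|) := by
  have hp := M.pMax_pos
  set C := 2 * M.pMax with hC
  have hC0 : 0 ≤ C := by positivity
  have hD0 : 0 < D := hδ.trans_le hD
  set L := D / x₀ + C / δ + D * C / (δ * x₀) + C / x₀ with hL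
  have hL0 : 0 ≤ L := by positivity
  refine ⟨1 + L, by positivity, ?_⟩
  intro u u' d d' w w' x x' h1 h2 h3 h4 h5 h6
  unfold regPrice
  refine (M.abs_clip_sub_clip_le _ _).trans ?_
  have hB : |max x x₀ - max x' x₀| ≤ |x - x'| := abs_max_sub_max_le_abs _ _ _
  have key := abs_min_div_sub_min_div_le (w := w) (w' := w') (B := max x x₀) (B' := max x' x₀)
    hδ h1 h2 h3 h4 h5 h6 hx₀ (le_max_right _ _) (le_max_right _ _) hC0
  rw [← hL] at key
  have key2 : |min (d * w / max x x₀) C - min (d' * w' / max x' x₀) C| ≤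
      L * (|d - d'| + |w - w'| + |x - x'|) := key.trans (by gcongr)
  have tri : |u / 2 + min (d * w / max x x₀) C / 2 - (u' / 2 + min (d' * w' / max x' x₀) C / 2)|
      ≤ |u - u'| / 2 + |min (d * w / max x x₀) C - min (d' * w' / max x' x₀) C| / 2 := by
    have e : u / 2 + min (d * w / max x x₀) C / 2 - (u' / 2 + min (d' * w' / max x' x₀) C / 2) =
      (u - u') / 2 + (min (d * w / max x x₀) C - min (d' * w' / max x' x₀) C) / 2 := by ring
    rw [e]
    refine (abs_add_le _ _).trans ?_
    rw [abs_div, abs_div, abs_two]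
  have a0 := abs_nonneg (u - u')
  have a1 := abs_nonneg (d - d')
  have a2 := abs_nonneg (w - w')
  have a3 := abs_nonneg (x - x')
  nlinarith [mul_nonneg hL0 a0, mul_nonneg hL0 a1, mul_nonneg hL0 a2, mul_nonneg hL0 a3]

/-- The profit maximizer for an estimated demand curve through `(u, q)` with slope `β = -x / w`. -/
lemma Market.eq_bestPrice_of_isMaxOn (M : Market) {u q w x α β p : ℝ}
    (hu : u ∈ Set.Icc M.pMin M.pMax) (hq : 0 < q) (hw : 0 < w) (hα : α = q - β * u)
    (hβ : β * w = -x) (hp : p ∈ Set.Icc M.pMin M.pMax)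
    (hmax : IsMaxOn (fun p : ℝ => p * (α + β * p)) (Set.Icc M.pMin M.pMax) p) :
    p = M.bestPrice u q w x := by
  have hlo := M.pMin_pos
  have hlt := M.pMin_lt_pMax
  have hm : ∀ r ∈ Set.Icc M.pMin M.pMax, r * (α + β * r) ≤ p * (α + β * p) := fun r hr => hmax hr
  unfold bestPrice
  split_ifs with hx
  · have hβ0 : β < 0 := by
      by_contra h
      push Not at h
      nlinarith [mul_nonneg h hw.le]
    set m := u / 2 + q * w / (2 * x) with hmdef
    -- With m the vertex, profit is β ((p - m)² - m²). As β < 0, maximizing it means minimizing the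
    -- distance to m, which the clip of m does.
    have hαm : α = -2 * β * m := by
      have hxe : x = -(β * w) := by linarith
      have : β * (q * w / (2 * x)) = - q / 2 := by
        rw [hxe]
        have := hβ0.ne
        field_simp
      rw [hα, hmdef]
      linear_combination 2 * this
    have hsq : ∀ r ∈ Set.Icc M.pMin M.pMax, (p - m) ^ 2 ≤ (r - m) ^ 2 := by
      intro r hr
      have h := hm r hr
      rw [hαm] at h
      have : 0 ≤ (-β) * ((r - m) ^ 2 - (p - m) ^ 2) := by linarith
      have := nonneg_of_mul_nonneg_right this (by linarith)
      linarith
    have h := hsq _ (M.clip_mem m)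
    rcases le_or_gt m M.pMin with h1 | h1
    · have e : M.clip m = M.pMin := by
        rw [clip, max_eq_right h1, min_eq_left hlt.le]
      rw [e] at h ⊢
      have := abs_le_of_sq_le_sq' h (by linarith)
      linarith [hp.1, this.2]
    rcases le_or_gt m M.pMax with h2 | h2
    · have e := M.clip_of_mem ⟨h1.le, h2⟩
      rw [e] at h ⊢
      have h0 : (p - m) ^ 2 = 0 := le_antisymm (by simpa using h) (sq_nonneg _)
      have := pow_eq_zero_iff (two_ne_zero) |>.1 h0
      linarith
    · have e := M.clip_of_ge h2.le
      rw [e] at h ⊢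
      have h' : (m - p) ^ 2 ≤ (m - M.pMax) ^ 2 := by linarith [sq_nonneg (m - p)]
      have := abs_le_of_sq_le_sq' h' (by linarith)
      linarith [hp.2, this.2]
  · have hβ0 : 0 ≤ β := by
      by_contra h
      push Not at h
      nlinarith [mul_pos (neg_pos.2 h) hw]
    have h := hm M.pMax ⟨hlt.le, le_rfl⟩
    -- This is the slope of the profit chord from p to `pMax`. It is positive because q > 0, so no p
    -- below `pMax` can be optimal.
    have hpos : 0 < q + β * (M.pMax + p - u) := by
      have : 0 ≤ β * (M.pMax + p - u) := mul_nonneg hβ0 (by linarith [hu.2, hp.1])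
      linarith
    have h2 : (M.pMax - p) * (q + β * (M.pMax + p - u)) ≤ 0 := by
      rw [hα] at h
      linarith
    have h3 : M.pMax - p ≤ 0 := by
      by_contra hc
      push Not at hc
      linarith [mul_pos hc hpos]
    linarith [hp.2]

/-- The chosen price depends on estimation errors in a Lipschitz way. -/
lemma Market.exists_bestPrice_perturb (M : Market) {δ D v x₀ : ℝ} (hδ : 0 < δ) (hD : 2 * δ ≤ D)
    (hv : 0 < v) (hx₀ : x₀ = δ * v / (2 * M.pMax)) :
    ∃ L : ℝ, 0 ≤ L ∧ ∀ u d w x e₁ e₂ : ℝ, 0 ≤ u → 2 * δ ≤ d → d ≤ D → v ≤ w →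
      |M.bestPrice u (d + e₁) w (x - e₂) - M.regPrice x₀ u d w x| ≤ L * (|e₁| + |e₂|) := by
  have hp := M.pMax_pos
  have hx₀pos : 0 < x₀ := by rw [hx₀]; positivity
  obtain ⟨L, hL0, hL⟩ := M.exists_regPrice_lipschitz (D := D + δ) hδ (by linarith) hx₀pos
  refine ⟨L + M.pMax / δ, by positivity, ?_⟩
  intro u d w x e₁ e₂ hu hd hdD hw
  have hLp : 0 ≤ M.pMax / δ := by positivity
  -- A small `e₁` keeps the perturbed demand above δ, so the Lipschitz bound applies. For a large
  -- `e₁` the trivial bound `pMax` is at most `pMax / δ * |e₁|`.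
  rcases le_or_gt |e₁| δ with h | h
  · have h' := abs_le.1 h
    rw [M.bestPrice_eq_regPrice hu hδ (by linarith) hv hw hx₀]
    refine (hL _ _ _ _ _ _ _ _ (by linarith) (by linarith) (by linarith) (by linarith)
      (by linarith) (by linarith)).trans ?_
    have : |u - u| + |d + e₁ - d| + |w - w| + |x - e₂ - x| = |e₁| + |e₂| := by
      simp
    rw [this]
    gcongr
    linarith
  · have h1 := M.bestPrice_mem u (d + e₁) w (x - e₂)
    have h2 := M.regPrice_mem x₀ u d w x
    have h3 : |M.bestPrice u (d + e₁) w (x - e₂) - M.regPrice x₀ u d w x| ≤ M.pMax := by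
      rw [abs_le]
      constructor <;> linarith [h1.1, h1.2, h2.1, h2.2, M.pMin_pos]
    have h4 : M.pMax ≤ M.pMax / δ * |e₁| := by
      rw [div_mul_eq_mul_div, le_div_iff₀ hδ]
      gcongr
    have a1 := abs_nonneg e₁
    have a2 := abs_nonneg e₂
    nlinarith [mul_nonneg hL0 a1, mul_nonneg hL0 a2, mul_nonneg hLp a2]

/-! ### Averages over the other firms -/

section OthersMean

variable {N : ℕ}

lemma othersMean_sub (x y : Fin N → ℝ) (i : Fin N) :
    othersMean (fun j => x j - y j) i = othersMean x i - othersMean y i := by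
  simp [othersMean, Finset.sum_sub_distrib, sub_div]

lemma othersMean_le (hN : 2 ≤ N) {x : Fin N → ℝ} {r : ℝ} (h : ∀ j, x j ≤ r) (i : Fin N) :
    othersMean x i ≤ r := by
  have hN' : (2 : ℝ) ≤ N := by exact_mod_cast hN
  unfold othersMean
  rw [div_le_iff₀ (by linarith)]
  refine (Finset.sum_le_card_nsmul _ _ r fun j _ => h j).trans (le_of_eq ?_)
  rw [Finset.card_erase_of_mem (Finset.mem_univ i), Finset.card_univ, Fintype.card_fin,
    nsmul_eq_mul, Nat.cast_sub (by omega)]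
  push_cast
  ring

lemma le_othersMean (hN : 2 ≤ N) {x : Fin N → ℝ} {r : ℝ} (h : ∀ j, r ≤ x j) (i : Fin N) :
    r ≤ othersMean x i := by
  have := othersMean_le hN (x := fun j => 0 - x j) (r := -r) (fun j => by linarith [h j]) i
  rw [othersMean_sub (fun _ => 0) x] at this
  have h0 : othersMean (fun _ : Fin N => (0 : ℝ)) i = 0 := by simp [othersMean]
  linarith

lemma abs_othersMean_sub_le (hN : 2 ≤ N) {x y : Fin N → ℝ} {r : ℝ} (h : ∀ j, |x j - y j| ≤ r)
    (i : Fin N) : |othersMean x i - othersMean y i| ≤ r := by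
  rw [← othersMean_sub, abs_le]
  exact ⟨le_othersMean hN (fun j => (abs_le.1 (h j)).1) i,
    othersMean_le hN (fun j => (abs_le.1 (h j)).2) i⟩

end OthersMean

/-! ### The regularized vector field -/

/-- The state space of the price-moments ODE. -/
abbrev Moments (N : ℕ) : Type := (Fin N → ℝ) × (Fin N → Fin N → ℝ)

namespace Market

variable {N : ℕ} (M : Market)

/-- A lower bound for half the expected demand at feasible prices. -/
def demandFloor : ℝ := M.c * M.pMin / 2

/-- The level below which the demand slope is truncated if price variances are at least `v`. -/
def slopeFloor (v : ℝ) : ℝ := M.demandFloor * v / (2 * M.pMax)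

lemma demandFloor_pos : 0 < M.demandFloor := by
  have := M.c_pos
  have := M.pMin_pos
  unfold demandFloor
  positivity

lemma slopeFloor_pos {v : ℝ} (hv : 0 < v) : 0 < M.slopeFloor v := by
  have := M.demandFloor_pos
  have := M.pMax_pos
  unfold slopeFloor
  positivity

/-- The posted prices, made globally Lipschitz by truncations that are inactive for feasible mean
prices and price variances at least `v`. -/
def regPosted (v : ℝ) (z : Moments N) (i : Fin N) : ℝ :=
  M.regPrice (M.slopeFloor v) (M.clip (z.1 i)) (expectedDemand M (fun j => M.clip (z.1 j)) i)
    (max (z.2 i i) v) (M.b * z.2 i i - M.c * othersMean (z.2 i) i)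

/-- Since `b * pMax ≤ a`, the own-price effect cannot exhaust the intercept, and the competitors
contribute at least `c * pMin`. The factor 2 leaves room for estimation errors up to `demandFloor`.
-/
lemma le_expectedDemand (hN : 2 ≤ N) {u : Fin N → ℝ} (hu : ∀ i, u i ∈ Set.Icc M.pMin M.pMax)
    (i : Fin N) : 2 * M.demandFloor ≤ expectedDemand M u i := by
  have h1 := le_othersMean hN (fun j => (hu j).1) i
  have h2 := M.b_mul_pMax_le
  have h3 := mul_le_mul_of_nonneg_left (hu i).2 M.b_pos.le
  have h4 := mul_le_mul_of_nonneg_left h1 M.c_pos.le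
  unfold demandFloor expectedDemand
  linarith

lemma expectedDemand_le (hN : 2 ≤ N) {u : Fin N → ℝ} (hu : ∀ i, u i ∈ Set.Icc M.pMin M.pMax)
    (i : Fin N) : expectedDemand M u i ≤ M.a + M.c * M.pMax := by
  have h1 := othersMean_le hN (fun j => (hu j).2) i
  have h3 : 0 ≤ M.b * u i := mul_nonneg M.b_pos.le (M.pMin_pos.le.trans (hu i).1)
  have h4 := mul_le_mul_of_nonneg_left h1 M.c_pos.le
  unfold expectedDemand
  linarith

lemma two_mul_demandFloor_le : 2 * M.demandFloor ≤ M.a + M.c * M.pMax := by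
  have := mul_le_mul_of_nonneg_left M.pMin_lt_pMax.le M.c_pos.le
  unfold demandFloor
  linarith [M.a_pos]

/-- The numerator of the ODE's price map splits into the part giving `u / 2` and the part giving
predicted demand times variance, which is the form of `bestPrice`. On this region all truncations
are inactive. -/
lemma postedPrice_eq_regPosted (hN : 2 ≤ N) {v : ℝ} (hv : 0 < v) {z : Moments N}
    (hu : ∀ i, z.1 i ∈ Set.Icc M.pMin M.pMax) (hw : ∀ i, v ≤ z.2 i i) :
    postedPrice M z.1 (Matrix.of z.2) = M.regPosted v z := by
  funext i
  have hclip : (fun j => M.clip (z.1 j)) = z.1 := funext fun j => M.clip_of_mem (hu j)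
  unfold regPosted
  rw [hclip, M.clip_of_mem (hu i), max_eq_left (hw i),
    ← M.bestPrice_eq_regPrice (x₀ := M.slopeFloor v) (M.pMin_pos.le.trans (hu i).1) M.demandFloor_pos
      (by linarith [M.le_expectedDemand hN hu i, M.demandFloor_pos]) hv (hw i) rfl]
  unfold postedPrice bestPrice
  have hcond : (-M.b * (Matrix.of z.2) i i + M.c * othersMean ((Matrix.of z.2) i) i < 0) ↔
      0 < M.b * z.2 i i - M.c * othersMean (z.2 i) i := by
    simp only [Matrix.of_apply]
    change (-M.b * z.2 i i + M.c * othersMean (z.2 i) i < 0) ↔ _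
    constructor <;> intro h <;> linarith
  simp only [hcond]
  split_ifs with h
  · unfold clip
    congr 2
    change ((M.a + M.c * othersMean z.1 i) * z.2 i i - M.c * z.1 i * othersMean (z.2 i) i) /
      (2 * (M.b * z.2 i i - M.c * othersMean (z.2 i) i)) = _
    unfold expectedDemand
    have h2 : 2 * (M.b * z.2 i i - M.c * othersMean (z.2 i) i) ≠ 0 := (mul_pos two_pos h).ne'
    rw [div_eq_iff h2, add_mul (z.1 i / 2), div_mul_cancel₀ _ h2]
    ring
  · rfl

lemma exists_regPosted_lipschitz (hN : 2 ≤ N) {v : ℝ} (hv : 0 < v) :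
    ∃ L : ℝ, 0 ≤ L ∧ ∀ (z z' : Moments N) (i : Fin N),
      |M.regPosted v z i - M.regPosted v z' i| ≤ L * ‖z - z'‖ := by
  obtain ⟨L, hL0, hL⟩ := M.exists_regPrice_lipschitz M.demandFloor_pos
    (D := M.a + M.c * M.pMax) (by linarith [M.two_mul_demandFloor_le, M.demandFloor_pos])
    (M.slopeFloor_pos hv)
  have hb := M.b_pos
  have hc := M.c_pos
  refine ⟨L * (2 + 2 * M.b + 2 * M.c), by positivity, ?_⟩
  intro z z' i
  set r := ‖z - z'‖ with hr
  have h1 : ∀ j, |z.1 j - z'.1 j| ≤ r := fun j =>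
    (norm_le_pi_norm (z - z').1 j).trans (norm_fst_le _)
  have h2 : ∀ j k, |z.2 j k - z'.2 j k| ≤ r := fun j k =>
    (norm_le_pi_norm ((z - z').2 j) k).trans
      ((norm_le_pi_norm (z - z').2 j).trans (norm_snd_le _))
  have h1' : ∀ j, |M.clip (z.1 j) - M.clip (z'.1 j)| ≤ r := fun j =>
    (M.abs_clip_sub_clip_le _ _).trans (h1 j)
  have hm := abs_othersMean_sub_le hN h1' i
  have hm2 := abs_othersMean_sub_le hN (h2 i) i
  have hd : |expectedDemand M (fun j => M.clip (z.1 j)) i -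
      expectedDemand M (fun j => M.clip (z'.1 j)) i| ≤ (M.b + M.c) * r := by
    unfold expectedDemand
    have e : ∀ p p' q q' : ℝ, M.a - M.b * p + M.c * q - (M.a - M.b * p' + M.c * q') =
      -(M.b * (p - p')) + M.c * (q - q') := fun _ _ _ _ => by ring
    rw [e]
    refine (abs_add_le _ _).trans ?_
    rw [abs_neg, abs_mul, abs_mul, abs_of_pos hb, abs_of_pos hc, add_mul]
    gcongr
    exact h1' i
  have hx : |M.b * z.2 i i - M.c * othersMean (z.2 i) i -
      (M.b * z'.2 i i - M.c * othersMean (z'.2 i) i)| ≤ (M.b + M.c) * r := by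
    have e : ∀ p p' q q' : ℝ, M.b * p - M.c * q - (M.b * p' - M.c * q') =
      (M.b * (p - p')) + -(M.c * (q - q')) := fun _ _ _ _ => by ring
    rw [e]
    refine (abs_add_le _ _).trans ?_
    rw [abs_neg, abs_mul, abs_mul, abs_of_pos hb, abs_of_pos hc, add_mul]
    gcongr
    exact h2 i i
  have hw : |max (z.2 i i) v - max (z'.2 i i) v| ≤ r :=
    (abs_max_sub_max_le_abs _ _ _).trans (h2 i i)
  have hcl := fun (y : Moments N) (j : Fin N) => M.clip_mem (y.1 j)
  refine (hL _ _ _ _ _ _ _ _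
    (by linarith [M.le_expectedDemand hN (hcl z) i, M.demandFloor_pos])
    (M.expectedDemand_le hN (hcl z) i)
    (by linarith [M.le_expectedDemand hN (hcl z') i, M.demandFloor_pos])
    (M.expectedDemand_le hN (hcl z') i)
    (hv.le.trans (le_max_right _ _)) (hv.le.trans (le_max_right _ _))).trans ?_
  rw [mul_assoc]
  gcongr
  linarith [h1' i]

/-- The gap between posted price and truncated mean price. -/
def gap (v : ℝ) (z : Moments N) (i : Fin N) : ℝ := M.regPosted v z i - M.clip (z.1 i)

/-- The regularized vector field of the price-moments ODE. -/
def field (v s : ℝ) (z : Moments N) : Moments N :=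
  (fun i => M.gap v z i / s, fun i j => M.gap v z i * M.gap v z j)

lemma abs_sub_le_pMax {x y : ℝ} (hx : x ∈ Set.Icc M.pMin M.pMax)
    (hy : y ∈ Set.Icc M.pMin M.pMax) : |x - y| ≤ M.pMax := by
  rw [abs_le]
  constructor <;> linarith [hx.1, hx.2, hy.1, hy.2, M.pMin_pos]

lemma regPosted_mem (v : ℝ) (z : Moments N) (i : Fin N) :
    M.regPosted v z i ∈ Set.Icc M.pMin M.pMax := M.regPrice_mem _ _ _ _ _

lemma abs_gap_le (v : ℝ) (z : Moments N) (i : Fin N) : |M.gap v z i| ≤ M.pMax :=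
  M.abs_sub_le_pMax (M.regPosted_mem v z i) (M.clip_mem _)

lemma norm_moments_le {z : Moments N} {r : ℝ} (hr : 0 ≤ r) (h1 : ∀ i, |z.1 i| ≤ r)
    (h2 : ∀ i j, |z.2 i j| ≤ r) : ‖z‖ ≤ r := by
  refine norm_prod_le_iff.2 ⟨(pi_norm_le_iff_of_nonneg hr).2 h1, ?_⟩
  refine (pi_norm_le_iff_of_nonneg hr).2 fun i => (pi_norm_le_iff_of_nonneg hr).2 (h2 i)

lemma norm_field_le (v : ℝ) {s : ℝ} (hs : 1 ≤ s) (z : Moments N) :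
    ‖M.field v s z‖ ≤ M.pMax + M.pMax ^ 2 := by
  have hp := M.pMax_pos
  refine norm_moments_le (by positivity) (fun i => ?_) fun i j => ?_
  · have h := M.abs_gap_le v z i
    simp only [field]
    rw [abs_div, abs_of_pos (by linarith : 0 < s)]
    have : |M.gap v z i| / s ≤ |M.gap v z i| := div_le_self (abs_nonneg _) hs
    nlinarith
  · simp only [field]
    rw [abs_mul]
    have := mul_le_mul (M.abs_gap_le v z i) (M.abs_gap_le v z j) (abs_nonneg _) hp.le
    nlinarith

lemma exists_field_lipschitz (hN : 2 ≤ N) {v : ℝ} (hv : 0 < v) :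
    ∃ L : ℝ, 0 ≤ L ∧ ∀ s, 1 ≤ s → ∀ z z' : Moments N,
      ‖M.field v s z - M.field v s z'‖ ≤ L * ‖z - z'‖ := by
  obtain ⟨L, hL0, hL⟩ := M.exists_regPosted_lipschitz hN hv
  have hp := M.pMax_pos
  refine ⟨(L + 1) * (1 + 2 * M.pMax), by positivity, ?_⟩
  intro s hs z z'
  have hn := norm_nonneg (z - z')
  have h1 : ∀ j, |z.1 j - z'.1 j| ≤ ‖z - z'‖ := fun j =>
    (norm_le_pi_norm (z - z').1 j).trans (norm_fst_le _)
  have hg : ∀ i, |M.gap v z i - M.gap v z' i| ≤ (L + 1) * ‖z - z'‖ := by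
    intro i
    unfold gap
    have e : ∀ p p' q q' : ℝ, p - q - (p' - q') = (p - p') - (q - q') := fun _ _ _ _ => by ring
    rw [e]
    refine (abs_sub _ _).trans ?_
    have := (M.abs_clip_sub_clip_le (z.1 i) (z'.1 i)).trans (h1 i)
    linarith [hL z z' i]
  refine norm_moments_le (by positivity) (fun i => ?_) fun i j => ?_
  · simp only [field, Prod.fst_sub, Pi.sub_apply]
    rw [← sub_div, abs_div, abs_of_pos (by linarith : 0 < s)]
    refine (div_le_self (abs_nonneg _) hs).trans ((hg i).trans ?_)
    gcongr
    nlinarith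
  · simp only [field, Prod.snd_sub, Pi.sub_apply]
    have e : ∀ p p' q q' : ℝ, p * q - p' * q' = (p - p') * q + p' * (q - q') :=
      fun _ _ _ _ => by ring
    rw [e]
    refine (abs_add_le _ _).trans ?_
    rw [abs_mul, abs_mul]
    have t1 := mul_le_mul (hg i) (M.abs_gap_le v z j) (abs_nonneg _) (by positivity)
    have t2 := mul_le_mul (M.abs_gap_le v z' i) (hg j) (abs_nonneg _) hp.le
    have : 0 ≤ (L + 1) * ‖z - z'‖ := by positivity
    nlinarith

lemma norm_field_sub_field_le (v : ℝ) {s s' : ℝ} (hs : 1 ≤ s) (hs' : 1 ≤ s') (z : Moments N) :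
    ‖M.field v s z - M.field v s' z‖ ≤ M.pMax * |s - s'| := by
  have hp := M.pMax_pos
  refine norm_moments_le (by positivity) (fun i => ?_) fun i j => ?_
  · simp only [field, Prod.fst_sub, Pi.sub_apply]
    have hs0 : 0 < s := by linarith
    have hs0' : 0 < s' := by linarith
    have e : M.gap v z i / s - M.gap v z i / s' = M.gap v z i * ((s' - s) / (s * s')) := by
      field_simp
    rw [e, abs_mul]
    have h1 : |(s' - s) / (s * s')| ≤ |s - s'| := by
      rw [abs_div, abs_sub_comm s' s, abs_of_pos (by positivity : 0 < s * s')]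
      exact div_le_self (abs_nonneg _) (by nlinarith)
    exact mul_le_mul (M.abs_gap_le v z i) h1 (abs_nonneg _) hp.le
  · simp only [field, Prod.snd_sub, Pi.sub_apply, sub_self, abs_zero]
    positivity

end Market

/-! ### Global solutions of Lipschitz differential equations -/

section GlobalODE

variable {E : Type*} [NormedAddCommGroup E] [NormedSpace ℝ E] {F : ℝ → E → E} {t₀ C L : ℝ}

lemma LipschitzWith.of_norm_sub_le_mul {E : Type*} [NormedAddCommGroup E] {f : E → E} {L : ℝ}
    (hL : 0 ≤ L) (h : ∀ x y, ‖f x - f y‖ ≤ L * ‖x - y‖) : LipschitzWith L.toNNReal f := by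
  refine LipschitzWith.of_dist_le_mul fun x y => ?_
  rw [dist_eq_norm, dist_eq_norm, Real.coe_toNNReal _ hL]
  exact h x y

/-- Derivatives within the interval yield right derivatives on its half-open part, so the Grönwall
uniqueness theorem applies. -/
lemma ode_unique_Icc (hL : 0 ≤ L)
    (hlip : ∀ t, t₀ ≤ t → ∀ x y, ‖F t x - F t y‖ ≤ L * ‖x - y‖) {b : ℝ} {f g : ℝ → E}
    (hf : ∀ t ∈ Set.Icc t₀ b, HasDerivWithinAt f (F t (f t)) (Set.Icc t₀ b) t)
    (hg : ∀ t ∈ Set.Icc t₀ b, HasDerivWithinAt g (F t (g t)) (Set.Icc t₀ b) t)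
    (h0 : f t₀ = g t₀) : Set.EqOn f g (Set.Icc t₀ b) := by
  have right : ∀ {h : ℝ → E},
      (∀ t ∈ Set.Icc t₀ b, HasDerivWithinAt h (F t (h t)) (Set.Icc t₀ b) t) →
      ∀ t ∈ Set.Ico t₀ b, HasDerivWithinAt h (F t (h t)) (Set.Ici t) t := by
    intro h hh t ht
    refine (hh t ⟨ht.1, ht.2.le⟩).mono_of_mem_nhdsWithin ?_
    exact mem_of_superset (Icc_mem_nhdsGE ht.2) (Set.Icc_subset_Icc_left ht.1)
  exact ODE_solution_unique_of_mem_Icc_right (v := F) (K := L.toNNReal) (s := fun _ => Set.univ)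
    (fun t ht => (LipschitzWith.of_norm_sub_le_mul hL (hlip t ht.1)).lipschitzOnWith)
    (fun t ht => (hf t ht).continuousWithinAt) (right hf) (fun _ _ => trivial)
    (fun t ht => (hg t ht).continuousWithinAt) (right hg) (fun _ _ => trivial) h0

lemma ode_unique_Ici (hL : 0 ≤ L)
    (hlip : ∀ t, t₀ ≤ t → ∀ x y, ‖F t x - F t y‖ ≤ L * ‖x - y‖) {f g : ℝ → E}
    (hf : ∀ t, t₀ ≤ t → HasDerivWithinAt f (F t (f t)) (Set.Ici t₀) t)
    (hg : ∀ t, t₀ ≤ t → HasDerivWithinAt g (F t (g t)) (Set.Ici t₀) t)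
    (h0 : f t₀ = g t₀) {t : ℝ} (ht : t₀ ≤ t) : f t = g t :=
  ode_unique_Icc (b := t) hL hlip (fun s hs => (hf s hs.1).mono Set.Icc_subset_Ici_self)
    (fun s hs => (hg s hs.1).mono Set.Icc_subset_Ici_self) h0 ⟨ht, le_rfl⟩

/-- A bounded vector field that is globally Lipschitz in space has global forward solutions. -/
theorem exists_global_solution [CompleteSpace E] (hC : 0 ≤ C) (hL : 0 ≤ L)
    (hbound : ∀ t, t₀ ≤ t → ∀ x, ‖F t x‖ ≤ C)
    (hlip : ∀ t, t₀ ≤ t → ∀ x y, ‖F t x - F t y‖ ≤ L * ‖x - y‖)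
    (hcont : ∀ x, ContinuousOn (fun t => F t x) (Set.Ici t₀)) (x₀ : E) :
    ∃ f : ℝ → E, f t₀ = x₀ ∧ ∀ t, t₀ ≤ t → HasDerivWithinAt f (F t (f t)) (Set.Ici t₀) t := by
  have hloc : ∀ n : ℕ, ∃ f : ℝ → E, f t₀ = x₀ ∧ ∀ t ∈ Set.Icc t₀ (t₀ + n),
      HasDerivWithinAt f (F t (f t)) (Set.Icc t₀ (t₀ + n)) t := by
    intro n
    have hn : (0 : ℝ) ≤ n := n.cast_nonneg
    have hmem : t₀ ∈ Set.Icc t₀ (t₀ + n) := ⟨le_rfl, by linarith⟩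
    -- The bounds on F are global, so the radius C n, which no solution can leave within time n, is
    -- admissible for every n.
    have hPL : IsPicardLindelof F (⟨t₀, hmem⟩ : Set.Icc t₀ (t₀ + n)) x₀ (C * n).toNNReal 0
        C.toNNReal L.toNNReal :=
      { lipschitzOnWith := fun t ht =>
          (LipschitzWith.of_norm_sub_le_mul hL (hlip t ht.1)).lipschitzOnWith
        continuousOn := fun x _ => (hcont x).mono Set.Icc_subset_Ici_self
        norm_le := fun t ht x _ => by
          rw [Real.coe_toNNReal _ hC]
          exact hbound t ht.1 x
        mul_max_le := by
          rw [Real.coe_toNNReal _ hC, Real.coe_toNNReal _ (by positivity)]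
          simp [hn] }
    exact hPL.exists_eq_forall_mem_Icc_hasDerivWithinAt₀
  choose f hf0 hf using hloc
  have hagree : ∀ m n : ℕ, m ≤ n → Set.EqOn (f m) (f n) (Set.Icc t₀ (t₀ + m)) := by
    intro m n hmn
    have hmn' : (m : ℝ) ≤ n := by exact_mod_cast hmn
    have hsub : Set.Icc t₀ (t₀ + m) ⊆ Set.Icc t₀ (t₀ + n) :=
      Set.Icc_subset_Icc_right (by linarith)
    exact ode_unique_Icc hL hlip (hf m) (fun t ht => (hf n t (hsub ht)).mono hsub)
      ((hf0 m).trans (hf0 n).symm)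
  have hval : ∀ (n : ℕ) (t : ℝ), t ∈ Set.Icc t₀ (t₀ + n) → f ⌈t - t₀⌉₊ t = f n t := by
    intro n t ht
    have h1 : ⌈t - t₀⌉₊ ≤ n := Nat.ceil_le.2 (by linarith [ht.2])
    exact hagree _ _ h1 ⟨ht.1, by linarith [Nat.le_ceil (t - t₀)]⟩
  refine ⟨fun t => f ⌈t - t₀⌉₊ t, by simpa using hf0 0, ?_⟩
  intro t ht
  -- The extra 1 makes t interior to the right end, so the solution on this interval describes the
  -- glued function near t.
  set n := ⌈t - t₀⌉₊ + 1 with hn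
  have htn : t < t₀ + n := by
    have := Nat.le_ceil (t - t₀)
    rw [hn]
    push_cast
    linarith
  have hd := hf n t ⟨ht, htn.le⟩
  rw [← hval n t ⟨ht, htn.le⟩] at hd
  have hd' := hd.congr (f₁ := fun t => f ⌈t - t₀⌉₊ t) (fun s hs => hval n s hs)
    (hval n t ⟨ht, htn.le⟩)
  refine hd'.mono_of_mem_nhdsWithin ?_
  rw [mem_nhdsWithin]
  exact ⟨Set.Iio (t₀ + n), isOpen_Iio, htn, fun s hs => ⟨hs.2, hs.1.le⟩⟩

/-- A barrier: a function that cannot increase above the level `c` stays below it. -/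
lemma le_of_deriv_nonpos_above {f f' : ℝ → ℝ} {c : ℝ}
    (hf : ∀ t, t₀ ≤ t → HasDerivWithinAt f (f' t) (Set.Ici t₀) t) (h0 : f t₀ ≤ c)
    (hneg : ∀ t, t₀ ≤ t → c ≤ f t → f' t ≤ 0) {t : ℝ} (ht : t₀ ≤ t) : f t ≤ c := by
  -- Tilting the barrier by slope ε gives the strict derivative inequality at contact points; ε is
  -- then sent to 0.
  have key : ∀ ε : ℝ, 0 < ε → f t ≤ c + ε * (t - t₀) := by
    intro ε hε
    refine image_le_of_deriv_right_lt_deriv_boundary (f := f) (f' := f') (a := t₀) (b := t)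
      (B := fun s => c + ε * (s - t₀)) (B' := fun _ => ε)
      (fun s hs => ((hf s hs.1).mono Set.Icc_subset_Ici_self).continuousWithinAt)
      (fun s hs => (hf s hs.1).mono (Set.Ici_subset_Ici.2 hs.1)) (by simpa using h0) ?_ ?_
      ⟨ht, le_rfl⟩
    · intro s
      simpa using (((hasDerivAt_id s).sub_const t₀).const_mul ε).const_add c
    · intro s hs hse
      refine (hneg s hs.1 ?_).trans_lt hε
      rw [hse]
      have := mul_nonneg hε.le (sub_nonneg.2 hs.1)
      linarith
  refine le_of_forall_pos_le_add fun η hη => ?_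
  have hpos : 0 < t - t₀ + 1 := by linarith
  refine (key (η / (t - t₀ + 1)) (by positivity)).trans ?_
  have : η / (t - t₀ + 1) * (t - t₀) ≤ η := by
    rw [div_mul_eq_mul_div, div_le_iff₀ hpos]
    nlinarith
  linarith

end GlobalODE

/-! ### Existence and uniqueness for the price-moments ODE -/

section PriceMoments

variable {N : ℕ} {M : Market} {v : ℝ} {μ : Fin N → ℝ} {S : Matrix (Fin N) (Fin N) ℝ}

/-- Solutions of the regularized equation have feasible mean prices and variances at least `v`. -/
lemma regular_region (hμ : ∀ i, μ i ∈ Set.Icc M.pMin M.pMax) (hS : ∀ i, v ≤ S i i)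
    {z : ℝ → Moments N} (h0 : z 1 = (μ, S))
    {p u : ℝ → Fin N → ℝ} (hp : ∀ s i, p s i ∈ Set.Icc M.pMin M.pMax)
    (hu : ∀ s i, M.pMax ≤ (z s).1 i → M.pMax ≤ u s i)
    (hl : ∀ s i, (z s).1 i ≤ M.pMin → u s i ≤ M.pMin)
    (h1 : ∀ s, 1 ≤ s → ∀ i,
      HasDerivWithinAt (fun r => (z r).1 i) ((p s i - u s i) / s) (Set.Ici 1) s)
    (h2 : ∀ s, 1 ≤ s → ∀ i, HasDerivWithinAt (fun r => (z r).2 i i)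
      ((p s i - u s i) * (p s i - u s i)) (Set.Ici 1) s) {s : ℝ} (hs : 1 ≤ s) (i : Fin N) :
    (z s).1 i ∈ Set.Icc M.pMin M.pMax ∧ v ≤ (z s).2 i i := by
  refine ⟨⟨?_, ?_⟩, ?_⟩
  -- Beyond either wall the drift points inward, because p is feasible and u is not strictly inside.
  -- Leaving p and u abstract covers both the original equation and the regularized one.
  · have := le_of_deriv_nonpos_above (t₀ := 1) (f := fun r => -(z r).1 i)
      (c := -M.pMin) (fun t ht => (h1 t ht i).neg) (by simp [h0, (hμ i).1])
      (fun t ht h => by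
        have h3 := hl t i (by linarith)
        have h4 : 0 ≤ (p t i - u t i) / t := div_nonneg (by linarith [(hp t i).1]) (by linarith)
        linarith) hs
    linarith
  · exact le_of_deriv_nonpos_above (t₀ := 1) (f := fun r => (z r).1 i)
      (fun t ht => h1 t ht i) (by simp [h0, (hμ i).2])
      (fun t ht h => div_nonpos_of_nonpos_of_nonneg
        (by linarith [(hp t i).2, hu t i h]) (by linarith)) hs
  · have := le_of_deriv_nonpos_above (t₀ := 1) (f := fun r => -(z r).2 i i)
      (c := -v) (fun t ht => (h2 t ht i).neg) (by
        have := hS i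
        simpa [h0] using this)
      (fun t ht h => by linarith [mul_self_nonneg (p t i - u t i)]) hs
    linarith

lemma postedPrice_mem (M : Market) (U : Fin N → ℝ) (V : Matrix (Fin N) (Fin N) ℝ) (i : Fin N) :
    postedPrice M U V i ∈ Set.Icc M.pMin M.pMax := by
  unfold postedPrice
  split_ifs
  · exact M.clip_mem _
  · exact ⟨M.pMin_lt_pMax.le, le_rfl⟩

lemma hasDerivWithinAt_moments_iff {z : ℝ → Moments N} {z' : Moments N} {A : Set ℝ} {s : ℝ} :
    HasDerivWithinAt z z' A s ↔ (∀ i, HasDerivWithinAt (fun r => (z r).1 i) (z'.1 i) A s) ∧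
      ∀ i j, HasDerivWithinAt (fun r => (z r).2 i j) (z'.2 i j) A s := by
  constructor
  · intro h
    have h1 : HasDerivWithinAt (fun r => (z r).1) z'.1 A s :=
      (ContinuousLinearMap.fst ℝ (Fin N → ℝ) (Fin N → Fin N → ℝ)).hasFDerivAt.comp_hasDerivWithinAt
        s h
    have h2 : HasDerivWithinAt (fun r => (z r).2) z'.2 A s :=
      (ContinuousLinearMap.snd ℝ (Fin N → ℝ) (Fin N → Fin N → ℝ)).hasFDerivAt.comp_hasDerivWithinAt
        s h
    exact ⟨hasDerivWithinAt_pi.1 h1, fun i => hasDerivWithinAt_pi.1 (hasDerivWithinAt_pi.1 h2 i)⟩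
  · rintro ⟨h1, h2⟩
    exact (hasDerivWithinAt_pi.2 h1).prodMk
      (hasDerivWithinAt_pi.2 fun i => hasDerivWithinAt_pi.2 (h2 i))

/-- A solution of the price-moments ODE solves the regularized equation. -/
lemma IsPriceMomentsSolution.hasDerivWithinAt_field (hN : 2 ≤ N) (hv : 0 < v)
    (hμ : ∀ i, μ i ∈ Set.Icc M.pMin M.pMax) (hS : ∀ i, v ≤ S i i) {U : ℝ → Fin N → ℝ}
    {V : ℝ → Matrix (Fin N) (Fin N) ℝ} (h : IsPriceMomentsSolution M μ S U V) {s : ℝ}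
    (hs : 1 ≤ s) :
    ((∀ i, U s i ∈ Set.Icc M.pMin M.pMax) ∧ ∀ i, v ≤ V s i i) ∧
    HasDerivWithinAt (fun r => ((U r, V r) : Moments N)) (M.field v s (U s, V s))
      (Set.Ici 1) s := by
  have hreg := fun i => regular_region (z := fun r => (U r, V r)) hμ hS
    (Prod.ext h.init_U h.init_V)
    (p := fun s => postedPrice M (U s) (V s)) (u := U) (fun s i => postedPrice_mem _ _ _ _)
    (fun _ _ h => h) (fun _ _ h => h) h.deriv_U (fun s hs i => h.deriv_V s hs i i) hs i
  refine ⟨⟨fun i => (hreg i).1, fun i => (hreg i).2⟩, ?_⟩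
  have e := M.postedPrice_eq_regPosted hN hv (z := (U s, V s)) (fun i => (hreg i).1)
    (fun i => (hreg i).2)
  have eg : ∀ i, M.gap v ((U s, V s) : Moments N) i = postedPrice M (U s) (V s) i - U s i := by
    intro i
    rw [Market.gap, ← e, M.clip_of_mem (hreg i).1]
    rfl
  rw [hasDerivWithinAt_moments_iff]
  simp only [Market.field, eg]
  exact ⟨h.deriv_U s hs, h.deriv_V s hs⟩

/-- The regularized field is bounded and Lipschitz, so it has a global solution. That solution never
leaves the region where regularization changes nothing. -/
theorem exists_isPriceMomentsSolution (hN : 2 ≤ N) (hv : 0 < v)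
    (hμ : ∀ i, μ i ∈ Set.Icc M.pMin M.pMax) (hS : ∀ i, v ≤ S i i) :
    ∃ (U : ℝ → Fin N → ℝ) (V : ℝ → Matrix (Fin N) (Fin N) ℝ), IsPriceMomentsSolution M μ S U V := by
  obtain ⟨L, hL0, hL⟩ := M.exists_field_lipschitz hN hv
  have hp := M.pMax_pos
  obtain ⟨z, hz0, hz⟩ := exists_global_solution (F := fun s z => M.field v s z) (t₀ := 1)
    (C := M.pMax + M.pMax ^ 2) (by positivity) hL0 (fun s hs z => M.norm_field_le v hs z) hL
    (fun z => by
      refine (LipschitzOnWith.of_dist_le_mul (K := M.pMax.toNNReal) fun s hs s' hs' => ?_).continuousOn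
      rw [dist_eq_norm, Real.dist_eq, Real.coe_toNNReal _ hp.le]
      exact M.norm_field_sub_field_le v hs hs' z) ((μ, S) : Moments N)
  have hz' := fun s hs => hasDerivWithinAt_moments_iff.1 (hz s hs)
  have hreg := fun s (hs : (1 : ℝ) ≤ s) i => regular_region (z := z) (v := v) hμ hS hz0
    (p := fun s => M.regPosted v (z s)) (u := fun s i => M.clip ((z s).1 i))
    (fun s i => M.regPosted_mem _ _ _)
    (fun s i h => (M.clip_of_ge h).ge)
    (fun s i h => by rw [Market.clip, max_eq_right h]; exact min_le_left _ _)
    (fun s hs => (hz' s hs).1) (fun s hs i => (hz' s hs).2 i i) hs i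
  have eg : ∀ s, 1 ≤ s → ∀ i,
      postedPrice M (z s).1 (z s).2 i - (z s).1 i = M.gap v (z s) i := by
    intro s hs i
    have e := M.postedPrice_eq_regPosted hN hv (z := z s) (fun i => (hreg s hs i).1)
      (fun i => (hreg s hs i).2)
    rw [Market.gap, ← e, M.clip_of_mem (hreg s hs i).1]
    rfl
  refine ⟨fun s => (z s).1, fun s => (z s).2, ?_, ?_, ?_, ?_⟩
  · simp [hz0]
  · simp [hz0]
  · intro s hs i
    rw [eg s hs i]
    exact (hz' s hs).1 i
  · intro s hs i j
    rw [eg s hs i, eg s hs j]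
    exact (hz' s hs).2 i j

/-- Every solution of the original equation automatically stays in the regular region, hence solves
the Lipschitz equation, where uniqueness holds. -/
theorem IsPriceMomentsSolution.unique (hN : 2 ≤ N) (hv : 0 < v)
    (hμ : ∀ i, μ i ∈ Set.Icc M.pMin M.pMax) (hS : ∀ i, v ≤ S i i) {U U' : ℝ → Fin N → ℝ}
    {V V' : ℝ → Matrix (Fin N) (Fin N) ℝ} (h : IsPriceMomentsSolution M μ S U V)
    (h' : IsPriceMomentsSolution M μ S U' V') {s : ℝ} (hs : 1 ≤ s) :
    U' s = U s ∧ V' s = V s := by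
  obtain ⟨L, hL0, hL⟩ := M.exists_field_lipschitz hN hv
  have := ode_unique_Ici (F := fun s z => M.field v s z) (t₀ := 1)
    (f := fun r => ((U' r, V' r) : Moments N)) (g := fun r => ((U r, V r) : Moments N)) hL0 hL
    (fun s hs => (h'.hasDerivWithinAt_field hN hv hμ hS hs).2)
    (fun s hs => (h.hasDerivWithinAt_field hN hv hμ hS hs).2)
    (by simp [h.init_U, h.init_V, h'.init_U, h'.init_V]) hs
  exact Prod.ext_iff.1 this

end PriceMoments

/-! ### Empirical price moments -/

section Empirical

variable {N : ℕ}

/-- The average prices over the periods `1, …, t`. -/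
def avgPrice (p : ℕ → Fin N → ℝ) (t : ℕ) (i : Fin N) : ℝ := (∑ s ∈ Finset.Icc 1 t, p s i) / t

/-- The sums of centered price products over the periods `1, …, t`. -/
def coMoment (p : ℕ → Fin N → ℝ) (t : ℕ) (i j : Fin N) : ℝ :=
  ∑ s ∈ Finset.Icc 1 t, (p s i - avgPrice p t i) * (p s j - avgPrice p t j)

/-- The empirical counterpart of the state of the price-moments ODE. -/
def empMoments (K : ℕ) (p : ℕ → Fin N → ℝ) (t : ℕ) : Moments N :=
  (avgPrice p t, fun i j => coMoment p t i j / K)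

lemma sum_eq_mul_avgPrice (p : ℕ → Fin N → ℝ) (t : ℕ) (i : Fin N) :
    ∑ s ∈ Finset.Icc 1 t, p s i = t * avgPrice p t i := by
  rcases Nat.eq_zero_or_pos t with rfl | ht
  · simp
  · have : (t : ℝ) ≠ 0 := by positivity
    rw [avgPrice, mul_div_cancel₀ _ this]

lemma coMoment_eq (p : ℕ → Fin N → ℝ) (t : ℕ) (i j : Fin N) :
    coMoment p t i j =
      ∑ s ∈ Finset.Icc 1 t, p s i * p s j - t * avgPrice p t i * avgPrice p t j := by
  have h : ∀ s, (p s i - avgPrice p t i) * (p s j - avgPrice p t j) =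
      p s i * p s j - avgPrice p t j * p s i - avgPrice p t i * p s j
        + avgPrice p t i * avgPrice p t j := fun s => by ring
  simp only [coMoment, h, Finset.sum_add_distrib, Finset.sum_sub_distrib, ← Finset.mul_sum,
    sum_eq_mul_avgPrice, Finset.sum_const, Nat.card_Icc, nsmul_eq_mul]
  simp only [add_tsub_cancel_right]
  ring

lemma avgPrice_succ (p : ℕ → Fin N → ℝ) (t : ℕ) (i : Fin N) :
    avgPrice p (t + 1) i = avgPrice p t i + (p (t + 1) i - avgPrice p t i) / (t + 1) := by
  have h := sum_eq_mul_avgPrice p (t + 1) i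
  rw [Finset.sum_Icc_succ_top (by omega), sum_eq_mul_avgPrice] at h
  push_cast at h
  have ht : (t : ℝ) + 1 ≠ 0 := by positivity
  field_simp
  linarith

/-- Welford's recursion. -/
lemma coMoment_succ (p : ℕ → Fin N → ℝ) (t : ℕ) (i j : Fin N) :
    coMoment p (t + 1) i j = coMoment p t i j +
      t / (t + 1) * ((p (t + 1) i - avgPrice p t i) * (p (t + 1) j - avgPrice p t j)) := by
  rw [coMoment_eq, coMoment_eq, Finset.sum_Icc_succ_top (by omega), avgPrice_succ, avgPrice_succ]
  have ht : (t : ℝ) + 1 ≠ 0 := by positivity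
  push_cast
  field_simp
  ring

/-- By Welford's recursion each increment is a nonnegative multiple of a square. Price variation
gained in exploration is thus never lost. -/
lemma coMoment_self_mono (p : ℕ → Fin N → ℝ) (i : Fin N) {t t' : ℕ} (h : t ≤ t') :
    coMoment p t i i ≤ coMoment p t' i i := by
  refine monotone_nat_of_le_succ (f := fun t => coMoment p t i i) (fun t => ?_) h
  simp only [coMoment_succ]
  have : 0 ≤ (t : ℝ) / (t + 1) *
    ((p (t + 1) i - avgPrice p t i) * (p (t + 1) i - avgPrice p t i)) :=
    mul_nonneg (by positivity) (mul_self_nonneg _)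
  linarith

lemma avgPrice_mem {p : ℕ → Fin N → ℝ} {t : ℕ} (ht : 1 ≤ t) {lo hi : ℝ} {i : Fin N}
    (hp : ∀ s ∈ Finset.Icc 1 t, p s i ∈ Set.Icc lo hi) : avgPrice p t i ∈ Set.Icc lo hi := by
  have ht' : (0 : ℝ) < t := by exact_mod_cast ht
  have h1 := Finset.card_nsmul_le_sum _ _ lo fun s hs => (hp s hs).1
  have h2 := Finset.sum_le_card_nsmul _ _ hi fun s hs => (hp s hs).2
  rw [Nat.card_Icc, nsmul_eq_mul, add_tsub_cancel_right] at h1 h2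
  unfold avgPrice
  exact ⟨by rw [le_div_iff₀ ht']; linarith, by rw [div_le_iff₀ ht']; linarith⟩

end Empirical

/-! ### Comparison of the empirical moments with the price-moments ODE -/

section Comparison

variable {N : ℕ} {M : Market} {v : ℝ}

/-- The empirical moments follow a perturbed Euler scheme with step `1 / K`. -/
lemma norm_empMoments_step_le {K t : ℕ} (hK : 1 ≤ K) (hKt : K ≤ t) {p : ℕ → Fin N → ℝ}
    (hp : ∀ i, p (t + 1) i ∈ Set.Icc M.pMin M.pMax)
    (hu : ∀ i, avgPrice p t i ∈ Set.Icc M.pMin M.pMax) {η : ℝ} (hη : 0 ≤ η)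
    (hclose : ∀ i, |p (t + 1) i - M.regPosted v (empMoments K p t) i| ≤ η) :
    ‖empMoments K p (t + 1) - empMoments K p t -
        (1 / K : ℝ) • M.field v (t / K) (empMoments K p t)‖ ≤
      (1 + 3 * M.pMax + M.pMax ^ 2) / K * (η + 1 / K) := by
  have hp0 := M.pMax_pos
  have hK' : (0 : ℝ) < K := by exact_mod_cast hK
  have hKt' : (K : ℝ) ≤ t := by exact_mod_cast hKt
  have ht' : (0 : ℝ) < t := hK'.trans_le hKt'
  set z := empMoments K p t with hz
  have hgap : ∀ i, M.gap v z i = M.regPosted v z i - avgPrice p t i := by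
    intro i
    rw [Market.gap]
    congr 1
    exact M.clip_of_mem (hu i)
  have hg : ∀ i, |M.gap v z i| ≤ M.pMax := M.abs_gap_le v z
  set g' : Fin N → ℝ := fun i => p (t + 1) i - avgPrice p t i with hg'def
  have hg' : ∀ i, |g' i| ≤ M.pMax := fun i => M.abs_sub_le_pMax (hp i) (hu i)
  have hd : ∀ i, |g' i - M.gap v z i| ≤ η := by
    intro i
    rw [hgap]
    simpa [hg'def] using hclose i
  have hinv : (1 : ℝ) / (t + 1) ≤ 1 / K := by
    gcongr
    linarith
  have hinv0 : (0 : ℝ) < 1 / (t + 1) := by positivity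
  have hKinv : (0 : ℝ) < 1 / K := by positivity
  have rhs : (1 + 3 * M.pMax + M.pMax ^ 2) / K * (η + 1 / K) =
      1 / K * ((1 + 3 * M.pMax + M.pMax ^ 2) * (η + 1 / K)) := by ring
  rw [rhs]
  refine Market.norm_moments_le (by positivity) (fun i => ?_) fun i j => ?_
  -- The Euler step moves the mean by gap / t, the true recursion by g' / (t + 1); the mismatch of
  -- the factors is 1 / (t (t + 1)) ≤ 1 / K².
  · have e : (empMoments K p (t + 1) - z - (1 / K : ℝ) • M.field v (t / K) z).1 i =
        1 / (t + 1) * (g' i - M.gap v z i) - 1 / (t + 1) * (1 / t * M.gap v z i) := by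
      simp only [Prod.fst_sub, Pi.sub_apply, Prod.smul_fst, Pi.smul_apply, smul_eq_mul,
        Market.field]
      have h1 : (empMoments K p (t + 1)).1 i = avgPrice p t i + g' i / (t + 1) :=
        avgPrice_succ p t i
      have h2 : z.1 i = avgPrice p t i := rfl
      rw [h1, h2]
      field_simp
      ring
    rw [e]
    have ht1 : (1 : ℝ) / t ≤ 1 / K := by gcongr
    have a1 : |1 / ((t : ℝ) + 1) * (g' i - M.gap v z i)| ≤ 1 / K * η := by
      rw [abs_mul, abs_of_pos hinv0]
      exact mul_le_mul hinv (hd i) (abs_nonneg _) hKinv.le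
    have a2 : |1 / ((t : ℝ) + 1) * (1 / t * M.gap v z i)| ≤ 1 / K * (1 / K * M.pMax) := by
      rw [abs_mul, abs_of_pos hinv0, abs_mul, abs_of_pos (by positivity : (0 : ℝ) < 1 / t)]
      exact mul_le_mul hinv (mul_le_mul ht1 (hg i) (abs_nonneg _) hKinv.le) (by positivity)
        hKinv.le
    refine (abs_sub _ _).trans ((add_le_add a1 a2).trans ?_)
    rw [← mul_add]
    refine mul_le_mul_of_nonneg_left ?_ hKinv.le
    nlinarith [mul_nonneg hp0.le hη, mul_nonneg (sq_nonneg M.pMax) hη,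
      mul_nonneg (sq_nonneg M.pMax) hKinv.le, mul_nonneg hp0.le hKinv.le]
  · have e : (empMoments K p (t + 1) - z - (1 / K : ℝ) • M.field v (t / K) z).2 i j =
        1 / K * (((g' i - M.gap v z i) * g' j + M.gap v z i * (g' j - M.gap v z j))
          - 1 / (t + 1) * (g' i * g' j)) := by
      simp only [Prod.snd_sub, Pi.sub_apply, Prod.smul_snd, Pi.smul_apply, smul_eq_mul,
        Market.field]
      have h1 : (empMoments K p (t + 1)).2 i j =
          (coMoment p t i j + t / (t + 1) * (g' i * g' j)) / K := by
        rw [← coMoment_succ p t i j]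
        rfl
      have h2 : z.2 i j = coMoment p t i j / K := rfl
      rw [h1, h2]
      field_simp
      ring
    rw [e, abs_mul, abs_of_pos hKinv]
    refine mul_le_mul_of_nonneg_left ?_ hKinv.le
    have a1 : |(g' i - M.gap v z i) * g' j| ≤ η * M.pMax := by
      rw [abs_mul]
      exact mul_le_mul (hd i) (hg' j) (abs_nonneg _) hη
    have a2 : |M.gap v z i * (g' j - M.gap v z j)| ≤ M.pMax * η := by
      rw [abs_mul]
      exact mul_le_mul (hg i) (hd j) (abs_nonneg _) hp0.le
    have a3 : |1 / ((t : ℝ) + 1) * (g' i * g' j)| ≤ 1 / K * (M.pMax * M.pMax) := by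
      rw [abs_mul, abs_of_pos hinv0, abs_mul]
      exact mul_le_mul hinv (mul_le_mul (hg' i) (hg' j) (abs_nonneg _) hp0.le) (by positivity)
        hKinv.le
    refine (abs_sub _ _).trans ((add_le_add ((abs_add_le _ _).trans (add_le_add a1 a2)) a3).trans ?_)
    nlinarith [mul_nonneg hp0.le hη, mul_nonneg (sq_nonneg M.pMax) hη,
      mul_nonneg (sq_nonneg M.pMax) hKinv.le, mul_nonneg hp0.le hKinv.le]

/-- Solutions of the regularized equation are Lipschitz and follow the Euler scheme up to a
quadratic error. -/
lemma exists_euler_bound (hN : 2 ≤ N) (hv : 0 < v) :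
    ∃ C : ℝ, 0 ≤ C ∧ ∀ z : ℝ → Moments N,
      (∀ s, 1 ≤ s → HasDerivWithinAt z (M.field v s (z s)) (Set.Ici 1) s) →
      (∀ s s', 1 ≤ s → s ≤ s' → ‖z s' - z s‖ ≤ C * (s' - s)) ∧
      ∀ s h, 1 ≤ s → 0 ≤ h → ‖z (s + h) - z s - h • M.field v s (z s)‖ ≤ C * h ^ 2 := by
  obtain ⟨L, hL0, hL⟩ := M.exists_field_lipschitz hN hv
  have hp := M.pMax_pos
  set B := M.pMax + M.pMax ^ 2 with hB
  have hB0 : 0 ≤ B := by positivity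
  refine ⟨B + (L * B + M.pMax), by positivity, ?_⟩
  intro z hz
  have hlip : ∀ s s', 1 ≤ s → s ≤ s' → ‖z s' - z s‖ ≤ B * (s' - s) := by
    intro s s' hs hss
    have := (convex_Icc s s').norm_image_sub_le_of_norm_hasDerivWithin_le
      (f := z) (f' := fun r => M.field v r (z r)) (C := B) (x := s) (y := s')
      (fun r hr => (hz r (hs.trans hr.1)).mono fun y hy => (hs.trans hy.1 : (1 : ℝ) ≤ y))
      (fun r hr => M.norm_field_le v (hs.trans hr.1) _) ⟨le_rfl, hss⟩ ⟨hss, le_rfl⟩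
    rwa [Real.norm_of_nonneg (sub_nonneg.2 hss)] at this
  refine ⟨fun s s' hs hss => (hlip s s' hs hss).trans ?_, ?_⟩
  · refine mul_le_mul_of_nonneg_right ?_ (sub_nonneg.2 hss)
    nlinarith [mul_nonneg hL0 hB0]
  intro s h hs hh
  have hmem : s + h ∈ Set.Icc s (s + h) := ⟨by linarith, le_rfl⟩
  -- Subtracting the linear motion with the field frozen at time s leaves a derivative of size O(h),
  -- hence an error O(h²).
  have := (convex_Icc s (s + h)).norm_image_sub_le_of_norm_hasDerivWithin_le
    (f := fun r => z r - r • M.field v s (z s))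
    (f' := fun r => M.field v r (z r) - (1 : ℝ) • M.field v s (z s))
    (C := (L * B + M.pMax) * h) (x := s) (y := s + h)
    (fun r hr => ((hz r (hs.trans hr.1)).mono fun y hy => (hs.trans hy.1 : (1 : ℝ) ≤ y)).sub
      ((hasDerivWithinAt_id r _).smul_const _))
    (fun r hr => by
      have h1 : (1 : ℝ) ≤ r := hs.trans hr.1
      have e : M.field v r (z r) - (1 : ℝ) • M.field v s (z s) =
          (M.field v r (z r) - M.field v r (z s)) + (M.field v r (z s) - M.field v s (z s)) := by
        rw [one_smul]; abel
      rw [e]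
      refine (norm_add_le _ _).trans ?_
      have t1 := hL r h1 (z r) (z s)
      have t2 := hlip s r hs hr.1
      have t3 := M.norm_field_sub_field_le v h1 hs (z s)
      rw [abs_of_nonneg (sub_nonneg.2 hr.1)] at t3
      have t4 : r - s ≤ h := by linarith [hr.2]
      have t5 : L * ‖z r - z s‖ ≤ L * (B * h) :=
        mul_le_mul_of_nonneg_left (t2.trans (mul_le_mul_of_nonneg_left t4 hB0)) hL0
      have t6 := mul_le_mul_of_nonneg_left t4 hp.le
      linarith) ⟨le_rfl, hmem.1⟩ hmem
  rw [add_sub_cancel_left, Real.norm_of_nonneg hh] at this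
  have e : z (s + h) - (s + h) • M.field v s (z s) - (z s - s • M.field v s (z s)) =
      z (s + h) - z s - h • M.field v s (z s) := by
    rw [add_smul]; abel
  rw [e] at this
  refine this.trans ?_
  nlinarith [mul_nonneg hB0 (sq_nonneg h)]

/-- The discrete Grönwall inequality on a finite time interval with constant rate. -/
lemma discrete_gronwall_le {g b : ℕ → ℝ} {κ : ℝ} {n₀ n : ℕ} (hκ : 0 ≤ κ) (hn : n₀ ≤ n)
    (hg : ∀ t, 0 ≤ g t) (hb : ∀ t, 0 ≤ b t)
    (hstep : ∀ t, n₀ ≤ t → t < n → g (t + 1) ≤ (1 + κ) * g t + b t) :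
    g n ≤ (g n₀ + ∑ t ∈ Finset.Ico n₀ n, b t) * Real.exp ((n - n₀ : ℕ) * κ) := by
  -- Setting g to 0 after n makes the one-step inequality hold at all later times as well.
  have := discrete_gronwall (u := fun t => if t ≤ n then g t else 0) (b := b) (c := fun _ => κ)
    (n₀ := n₀) (by simp [hn, hg]) (fun t ht => by
      by_cases h : t + 1 ≤ n
      · rw [if_pos h, if_pos (by omega)]
        exact hstep t ht (by omega)
      · rw [if_neg h]
        have : 0 ≤ (if t ≤ n then g t else 0) := by split_ifs <;> simp [hg]
        have := hb t
        positivity) (fun _ _ => hκ) (fun t _ => hb t) hn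
  simpa [hn] using this

/-- Deviation of the final price from the price-moments ODE in terms of the initial deviation and
of the deviations `η t` of the posted prices from the price map. -/
theorem exists_price_deviation_bound (hN : 2 ≤ N) (hv : 0 < v) (S : ℝ) :
    ∃ C : ℝ, 0 ≤ C ∧ ∀ z : ℝ → Moments N,
      (∀ s, 1 ≤ s → HasDerivWithinAt z (M.field v s (z s)) (Set.Ici 1) s) →
      ∀ (K n : ℕ) (p : ℕ → Fin N → ℝ) (η : ℕ → ℝ), 1 ≤ K → K ≤ n → (n : ℝ) / K ≤ S →
        (∀ t ∈ Finset.Icc 1 (n + 1), ∀ i, p t i ∈ Set.Icc M.pMin M.pMax) →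
        (∀ t, 0 ≤ η t) →
        (∀ t, K ≤ t → t ≤ n → ∀ i,
          |p (t + 1) i - M.regPosted v (empMoments K p t) i| ≤ η t) →
        ∀ i, |p (n + 1) i - M.regPosted v (z (n / K)) i| ≤
          C * (‖empMoments K p K - z 1‖ + (∑ t ∈ Finset.Ico K n, η t) / K + η n + 1 / K) := by
  obtain ⟨L, hL0, hL⟩ := M.exists_field_lipschitz hN hv
  obtain ⟨L₁, hL₁0, hL₁⟩ := M.exists_regPosted_lipschitz hN hv
  obtain ⟨C₁, hC₁0, hC₁⟩ := exists_euler_bound (M := M) hN hv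
  have hp := M.pMax_pos
  set C₂ := 1 + 3 * M.pMax + M.pMax ^ 2 with hC₂
  have hC₂0 : 0 ≤ C₂ := by positivity
  -- S may be negative; its positive part keeps the constants nonnegative.
  set S' := max S 0 with hS'
  have hS'0 : 0 ≤ S' := le_max_right _ _
  set G := (1 + C₂ + (C₂ + C₁) * S') * Real.exp (S' * L) with hG
  have hG0 : 0 ≤ G := by positivity
  refine ⟨1 + L₁ * G, by positivity, ?_⟩
  intro z hz K n p η hK hKn hS hbox hη hclose i
  have hK' : (0 : ℝ) < K := by exact_mod_cast hK
  set g : ℕ → ℝ := fun t => ‖empMoments K p t - z (t / K)‖ with hgdef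
  set b : ℕ → ℝ := fun t => C₂ / K * η t + (C₂ + C₁) / K ^ 2 with hbdef
  have hstep : ∀ t, K ≤ t → t < n → g (t + 1) ≤ (1 + L / K) * g t + b t := by
    intro t hKt htn
    have hKt' : (K : ℝ) ≤ t := by exact_mod_cast hKt
    have hs : (1 : ℝ) ≤ t / K := by rwa [le_div_iff₀ hK', one_mul]
    have h1 := norm_empMoments_step_le (M := M) (v := v) (p := p) hK hKt
      (hbox (t + 1) (Finset.mem_Icc.2 ⟨by omega, by omega⟩))
      (fun i => avgPrice_mem (by omega) fun s hs' =>
        hbox s (Finset.mem_Icc.2 ⟨(Finset.mem_Icc.1 hs').1, by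
          have := (Finset.mem_Icc.1 hs').2
          omega⟩) i) (hη t) (hclose t hKt htn.le)
    have h2 := (hC₁ z hz).2 (t / K) (1 / K) hs (by positivity)
    have h3 := hL (t / K) hs (empMoments K p t) (z (t / K))
    have hts : ((t + 1 : ℕ) : ℝ) / K = t / K + 1 / K := by push_cast; ring
    -- Error of the discrete step, minus the Euler error of the ODE, plus the propagated old error
    -- with the difference of the fields.
    have e : empMoments K p (t + 1) - z (t / K + 1 / K) =
        (empMoments K p (t + 1) - empMoments K p t -
          (1 / K : ℝ) • M.field v (t / K) (empMoments K p t)) -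
        (z (t / K + 1 / K) - z (t / K) - (1 / K : ℝ) • M.field v (t / K) (z (t / K))) +
        ((empMoments K p t - z (t / K)) +
          (1 / K : ℝ) • (M.field v (t / K) (empMoments K p t) - M.field v (t / K) (z (t / K)))) := by
      rw [smul_sub]; abel
    simp only [hgdef, hbdef]
    rw [hts, e]
    refine (norm_add_le _ _).trans ?_
    have h4 := norm_sub_le (empMoments K p (t + 1) - empMoments K p t -
          (1 / K : ℝ) • M.field v (t / K) (empMoments K p t))
        (z (t / K + 1 / K) - z (t / K) - (1 / K : ℝ) • M.field v (t / K) (z (t / K)))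
    have h5 := norm_add_le (empMoments K p t - z (t / K))
          ((1 / K : ℝ) • (M.field v (t / K) (empMoments K p t) - M.field v (t / K) (z (t / K))))
    rw [norm_smul, Real.norm_of_nonneg (by positivity : (0 : ℝ) ≤ 1 / K)] at h5
    have h6 := mul_le_mul_of_nonneg_left h3 (by positivity : (0 : ℝ) ≤ 1 / K)
    have e1 : C₂ / K * (η t + 1 / K) + C₁ * (1 / (K : ℝ)) ^ 2 =
        C₂ / K * η t + (C₂ + C₁) / K ^ 2 := by ring
    have e2 : (1 + L / K) * ‖empMoments K p t - z (t / K)‖ =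
      ‖empMoments K p t - z (t / K)‖ + 1 / K * (L * ‖empMoments K p t - z (t / K)‖) := by ring
    rw [e2, ← e1]
    linarith
  have hgr := discrete_gronwall_le (g := g) (b := b) (κ := L / K) (by positivity) hKn
    (fun t => norm_nonneg _) (fun t => by have := hη t; positivity) hstep
  have hsub : ((n - K : ℕ) : ℝ) ≤ S' * K := by
    have h1 : ((n - K : ℕ) : ℝ) ≤ n := by exact_mod_cast Nat.sub_le n K
    have h2 : (n : ℝ) ≤ S * K := (div_le_iff₀ hK').1 hS
    have h3 : S * K ≤ S' * K := mul_le_mul_of_nonneg_right (le_max_left _ _) hK'.le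
    linarith
  have hexp : Real.exp ((n - K : ℕ) * (L / K)) ≤ Real.exp (S' * L) := by
    refine Real.exp_le_exp.2 ?_
    calc ((n - K : ℕ) : ℝ) * (L / K) ≤ S' * K * (L / K) := by gcongr
      _ = S' * L := by field_simp
  have hsum0 : 0 ≤ ∑ t ∈ Finset.Ico K n, η t := Finset.sum_nonneg fun t _ => hη t
  have hsum : ∑ t ∈ Finset.Ico K n, b t ≤
      C₂ * ((∑ t ∈ Finset.Ico K n, η t) / K) + (C₂ + C₁) * S' * (1 / K) := by
    simp only [hbdef]
    rw [Finset.sum_add_distrib, ← Finset.mul_sum, Finset.sum_const, Nat.card_Ico, nsmul_eq_mul]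
    have h1 : ((n - K : ℕ) : ℝ) * ((C₂ + C₁) / K ^ 2) ≤ S' * K * ((C₂ + C₁) / K ^ 2) := by gcongr
    have h2 : S' * K * ((C₂ + C₁) / (K : ℝ) ^ 2) = (C₂ + C₁) * S' * (1 / K) := by field_simp
    have h3 : C₂ / K * (∑ t ∈ Finset.Ico K n, η t) =
      C₂ * ((∑ t ∈ Finset.Ico K n, η t) / K) := by ring
    linarith
  have hgK : g K = ‖empMoments K p K - z 1‖ := by
    simp only [hgdef]
    rw [div_self hK'.ne']
  set I := ‖empMoments K p K - z 1‖ with hI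
  set A := (∑ t ∈ Finset.Ico K n, η t) / (K : ℝ) with hA
  have hI0 : 0 ≤ I := norm_nonneg _
  have hA0 : 0 ≤ A := by positivity
  have hKi : (0 : ℝ) ≤ 1 / K := by positivity
  have hηn := hη n
  have hgn : g n ≤ G * (I + A + η n + 1 / K) := by
    have hin : g K + ∑ t ∈ Finset.Ico K n, b t ≤
        (1 + C₂ + (C₂ + C₁) * S') * (I + A + η n + 1 / K) := by
      rw [hgK]
      have hc : 0 ≤ (C₂ + C₁) * S' := by positivity
      nlinarith [mul_nonneg hC₂0 hI0, mul_nonneg hC₂0 hηn, mul_nonneg hC₂0 hKi,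
        mul_nonneg hc hI0, mul_nonneg hc hA0, mul_nonneg hc hηn]
    refine hgr.trans ?_
    rw [hG]
    calc _ ≤ ((1 + C₂ + (C₂ + C₁) * S') * (I + A + η n + 1 / K)) * Real.exp (S' * L) := by
          gcongr
      _ = _ := by ring
  have h1 := hclose n hKn le_rfl i
  have h2 := hL₁ (empMoments K p n) (z (n / K)) i
  have h3 : L₁ * ‖empMoments K p n - z (n / K)‖ ≤ L₁ * (G * (I + A + η n + 1 / K)) :=
    mul_le_mul_of_nonneg_left hgn hL₁0
  have h4 := abs_sub_le (p (n + 1) i) (M.regPosted v (empMoments K p n) i)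
    (M.regPosted v (z (n / K)) i)
  linarith

end Comparison

/-! ### Least squares -/

section LeastSquares

/-- A residual that cannot be shortened along y is orthogonal to y. Taking y to be constant or the
prices gives the two normal equations. -/
lemma sum_mul_eq_zero_of_sum_sq_le {ι : Type*} {A : Finset ι} {r y : ι → ℝ}
    (h : ∀ c : ℝ, ∑ s ∈ A, r s ^ 2 ≤ ∑ s ∈ A, (r s - c * y s) ^ 2) : ∑ s ∈ A, r s * y s = 0 := by
  set a := ∑ s ∈ A, r s * y s with ha
  set b := ∑ s ∈ A, y s ^ 2 with hb
  have hb0 : 0 ≤ b := Finset.sum_nonneg fun s _ => sq_nonneg _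
  have hexp : ∀ c : ℝ, 0 ≤ c ^ 2 * b - 2 * c * a := by
    intro c
    have e : ∑ s ∈ A, (r s - c * y s) ^ 2 = ∑ s ∈ A, r s ^ 2 - 2 * c * a + c ^ 2 * b := by
      rw [ha, hb, Finset.mul_sum, Finset.mul_sum, ← Finset.sum_sub_distrib,
        ← Finset.sum_add_distrib]
      exact Finset.sum_congr rfl fun s _ => by ring
    linarith [h c]
  -- The denominator b + 1 instead of b covers the case y = 0.
  have h1 := hexp (a / (b + 1))
  have hb1 : 0 < b + 1 := by linarith
  have e : (a / (b + 1)) ^ 2 * b - 2 * (a / (b + 1)) * a = -(a ^ 2 * (b + 2)) / (b + 1) ^ 2 := by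
    field_simp
    ring
  rw [e] at h1
  have h2 : 0 ≤ -(a ^ 2 * (b + 2)) := by
    by_contra hc
    push Not at hc
    linarith [div_neg_of_neg_of_pos hc (by positivity : 0 < (b + 1) ^ 2)]
  have h3 : a ^ 2 = 0 := by nlinarith [sq_nonneg a]
  exact pow_eq_zero_iff two_ne_zero |>.1 h3

variable {x q : ℕ → ℝ} {t : ℕ} {α β : ℝ}

lemma IsOLSFit.normal_eq_one (h : IsOLSFit x q t α β) :
    ∑ s ∈ Finset.Icc 1 t, (q s - (α + β * x s)) = 0 := by
  have := sum_mul_eq_zero_of_sum_sq_le (A := Finset.Icc 1 t)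
    (r := fun s => q s - (α + β * x s)) (y := fun _ => 1) (fun c => by
      refine (h (α + c) β).trans (le_of_eq (Finset.sum_congr rfl fun s _ => ?_))
      ring)
  simpa using this

lemma IsOLSFit.normal_eq_price (h : IsOLSFit x q t α β) :
    ∑ s ∈ Finset.Icc 1 t, (q s - (α + β * x s)) * x s = 0 :=
  sum_mul_eq_zero_of_sum_sq_le (A := Finset.Icc 1 t)
    (r := fun s => q s - (α + β * x s)) (y := x) (fun c => by
      refine (h α (β + c)).trans (le_of_eq (Finset.sum_congr rfl fun s _ => ?_))
      ring)

lemma IsOLSFit.intercept_eq (h : IsOLSFit x q t α β) (ht : 1 ≤ t) :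
    α = (∑ s ∈ Finset.Icc 1 t, q s) / t - β * ((∑ s ∈ Finset.Icc 1 t, x s) / t) := by
  have h1 := h.normal_eq_one
  have ht' : (t : ℝ) ≠ 0 := by
    have : t ≠ 0 := by omega
    exact_mod_cast this
  rw [Finset.sum_sub_distrib, Finset.sum_add_distrib, ← Finset.mul_sum, Finset.sum_const,
    Nat.card_Icc, nsmul_eq_mul, add_tsub_cancel_right] at h1
  field_simp
  linarith

/-- Combine the normal equations with the fact that centered prices sum to zero. In product form no
nonzero variance is required. -/
lemma IsOLSFit.slope_mul_eq (h : IsOLSFit x q t α β) (ht : 1 ≤ t) :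
    β * ∑ s ∈ Finset.Icc 1 t, (x s - (∑ s ∈ Finset.Icc 1 t, x s) / t) *
        (x s - (∑ s ∈ Finset.Icc 1 t, x s) / t) =
      ∑ s ∈ Finset.Icc 1 t, (x s - (∑ s ∈ Finset.Icc 1 t, x s) / t) * q s := by
  set u := (∑ s ∈ Finset.Icc 1 t, x s) / t with hu
  have h1 := h.normal_eq_one
  have h2 := h.normal_eq_price
  have ht' : (t : ℝ) ≠ 0 := by
    have : t ≠ 0 := by omega
    exact_mod_cast this
  have hx : ∑ s ∈ Finset.Icc 1 t, x s = t * u := by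
    rw [hu]
    field_simp
  have h3 : ∑ s ∈ Finset.Icc 1 t, (x s - u) = 0 := by
    rw [Finset.sum_sub_distrib, hx, Finset.sum_const, Nat.card_Icc, nsmul_eq_mul,
      add_tsub_cancel_right, sub_self]
  have e : ∑ s ∈ Finset.Icc 1 t, (x s - u) * q s =
      ∑ s ∈ Finset.Icc 1 t, (q s - (α + β * x s)) * x s
      - u * ∑ s ∈ Finset.Icc 1 t, (q s - (α + β * x s))
      + (α + β * u) * ∑ s ∈ Finset.Icc 1 t, (x s - u)
      + β * ∑ s ∈ Finset.Icc 1 t, (x s - u) * (x s - u) := by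
    simp only [Finset.mul_sum]
    rw [← Finset.sum_sub_distrib, ← Finset.sum_add_distrib, ← Finset.sum_add_distrib]
    exact Finset.sum_congr rfl fun s _ => by ring
  rw [e, h1, h2, h3]
  ring

end LeastSquares

/-! ### The price of a firm that has fitted a demand curve -/

section Fitted

variable {N : ℕ} {M : Market}

/-- The price computed from the price and quantity histories up to period `t`; all second moments
are divided by `K`. -/
def fittedPrice (M : Market) (K : ℕ) (p q : ℕ → Fin N → ℝ) (t : ℕ) (i : Fin N) : ℝ :=
  M.bestPrice (avgPrice p t i) ((∑ s ∈ Finset.Icc 1 t, q s i) / t) (coMoment p t i i / K)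
    (-(∑ s ∈ Finset.Icc 1 t, (p s i - avgPrice p t i) * q s i) / K)

lemma fittedPrice_mem (M : Market) (K : ℕ) (p q : ℕ → Fin N → ℝ) (t : ℕ) (i : Fin N) :
    fittedPrice M K p q t i ∈ Set.Icc M.pMin M.pMax :=
  M.bestPrice_mem _ _ _ _

/-- A positive centered sum of squares determines the fit, and positive sales make the profit
maximizer unique for either sign of the slope. The common factor 1 / K cancels in the price formula.
-/
lemma eq_fittedPrice {K t : ℕ} (hK : 1 ≤ K) (ht : 1 ≤ t) {p q : ℕ → Fin N → ℝ} {i : Fin N}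
    (hp : ∀ s ∈ Finset.Icc 1 t, p s i ∈ Set.Icc M.pMin M.pMax)
    (hq : ∀ s ∈ Finset.Icc 1 t, 0 < q s i) (hw : 0 < coMoment p t i i) {r : ℝ}
    (h : ∃ α β : ℝ, IsOLSFit (fun s => p s i) (fun s => q s i) t α β ∧
      r ∈ Set.Icc M.pMin M.pMax ∧
      IsMaxOn (fun p : ℝ => p * (α + β * p)) (Set.Icc M.pMin M.pMax) r) :
    r = fittedPrice M K p q t i := by
  obtain ⟨α, β, hfit, hr, hmax⟩ := h
  have ht' : (0 : ℝ) < t := by exact_mod_cast ht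
  have hK' : (0 : ℝ) < K := by exact_mod_cast hK
  refine M.eq_bestPrice_of_isMaxOn (α := α) (β := β) (avgPrice_mem ht hp) ?_ (by positivity)
    (hfit.intercept_eq ht) ?_ hr hmax
  · refine div_pos (Finset.sum_pos hq ⟨1, Finset.mem_Icc.2 ⟨le_rfl, ht⟩⟩) ht'
  · have := hfit.slope_mul_eq ht
    have e : β * coMoment p t i i = ∑ s ∈ Finset.Icc 1 t, (p s i - avgPrice p t i) * q s i := this
    rw [← mul_div_assoc, e]
    ring

lemma othersMean_sum {ι : Type*} (A : Finset ι) (f : ι → Fin N → ℝ) (i : Fin N) :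
    othersMean (fun j => ∑ s ∈ A, f s j) i = ∑ s ∈ A, othersMean (f s) i := by
  simp only [othersMean]
  rw [Finset.sum_comm, Finset.sum_div]

lemma othersMean_const_mul (c : ℝ) (f : Fin N → ℝ) (i : Fin N) :
    othersMean (fun j => c * f j) i = c * othersMean f i := by
  simp only [othersMean]
  rw [← Finset.mul_sum, mul_div_assoc]

lemma othersMean_div (c : ℝ) (f : Fin N → ℝ) (i : Fin N) :
    othersMean (fun j => f j / c) i = othersMean f i / c := by
  simp only [othersMean]
  rw [← Finset.sum_div, div_right_comm]

variable {K t : ℕ} {p q e : ℕ → Fin N → ℝ} {i : Fin N}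

lemma avg_quantity_eq (ht : 1 ≤ t)
    (hq : ∀ s ∈ Finset.Icc 1 t, q s i = expectedDemand M (p s) i + e s i) :
    (∑ s ∈ Finset.Icc 1 t, q s i) / t =
      expectedDemand M (avgPrice p t) i + (∑ s ∈ Finset.Icc 1 t, e s i) / t := by
  have ht' : (t : ℝ) ≠ 0 := by
    have : t ≠ 0 := by omega
    exact_mod_cast this
  have hm : othersMean (avgPrice p t) i = (∑ s ∈ Finset.Icc 1 t, othersMean (p s) i) / t := by
    rw [← othersMean_sum, ← othersMean_div]
    rfl
  rw [Finset.sum_congr rfl hq]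
  unfold expectedDemand
  rw [hm]
  simp only [Finset.sum_add_distrib, Finset.sum_sub_distrib, ← Finset.mul_sum,
    sum_eq_mul_avgPrice, Finset.sum_const, Nat.card_Icc, nsmul_eq_mul, add_tsub_cancel_right]
  field_simp

/-- Regressing on the own price only, a firm attributes the comovement of competitors' prices to
itself; this omitted-variable bias is the c-term. The intercept drops out because centered prices
sum to zero. -/
lemma sum_centered_mul_quantity_eq (hq : ∀ s ∈ Finset.Icc 1 t,
      q s i = expectedDemand M (p s) i + e s i) :
    -(∑ s ∈ Finset.Icc 1 t, (p s i - avgPrice p t i) * q s i) =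
      M.b * coMoment p t i i - M.c * othersMean (coMoment p t i) i
        - ∑ s ∈ Finset.Icc 1 t, (p s i - avgPrice p t i) * e s i := by
  have h0 : ∑ s ∈ Finset.Icc 1 t, (p s i - avgPrice p t i) = 0 := by
    rw [Finset.sum_sub_distrib, sum_eq_mul_avgPrice, Finset.sum_const, Nat.card_Icc, nsmul_eq_mul,
      add_tsub_cancel_right, sub_self]
  have hm : othersMean (coMoment p t i) i = ∑ s ∈ Finset.Icc 1 t,
      (p s i - avgPrice p t i) * (othersMean (p s) i - othersMean (avgPrice p t) i) := by
    have : coMoment p t i = fun j => ∑ s ∈ Finset.Icc 1 t,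
      (p s i - avgPrice p t i) * (p s j - avgPrice p t j) := rfl
    rw [this, othersMean_sum]
    refine Finset.sum_congr rfl fun s _ => ?_
    rw [othersMean_const_mul, othersMean_sub]
  have e1 : ∑ s ∈ Finset.Icc 1 t, (p s i - avgPrice p t i) * q s i =
      expectedDemand M (avgPrice p t) i * ∑ s ∈ Finset.Icc 1 t, (p s i - avgPrice p t i)
      - M.b * coMoment p t i i + M.c * othersMean (coMoment p t i) i
      + ∑ s ∈ Finset.Icc 1 t, (p s i - avgPrice p t i) * e s i := by
    rw [hm, coMoment]
    simp only [Finset.mul_sum]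
    rw [← Finset.sum_sub_distrib, ← Finset.sum_add_distrib, ← Finset.sum_add_distrib]
    refine Finset.sum_congr rfl fun s hs => ?_
    rw [hq s hs]
    unfold expectedDemand
    ring
  rw [e1, h0]
  ring

/-- The fitted price is close to the price map at the empirical moments, up to normalized sums of
the demand shocks. -/
lemma exists_fittedPrice_bound (M : Market) (hN : 2 ≤ N) {v : ℝ} (hv : 0 < v) :
    ∃ L : ℝ, 0 ≤ L ∧ ∀ (K t : ℕ) (p q e : ℕ → Fin N → ℝ) (i : Fin N), 1 ≤ K → K ≤ t →
      (∀ s ∈ Finset.Icc 1 t, ∀ j, p s j ∈ Set.Icc M.pMin M.pMax) →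
      (∀ s ∈ Finset.Icc 1 t, q s i = expectedDemand M (p s) i + e s i) →
      v ≤ coMoment p t i i / K →
      |fittedPrice M K p q t i - M.regPosted v (empMoments K p t) i| ≤
        L * (|∑ s ∈ Finset.Icc 1 t, e s i| / K + |∑ s ∈ Finset.Icc 1 t, p s i * e s i| / K) := by
  obtain ⟨L, hL0, hL⟩ := M.exists_bestPrice_perturb M.demandFloor_pos M.two_mul_demandFloor_le hv
    (x₀ := M.slopeFloor v) rfl
  have hp0 := M.pMax_pos
  refine ⟨L * (1 + M.pMax), by positivity, ?_⟩
  intro K t p q e i hK hKt hp hq hw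
  have ht : 1 ≤ t := hK.trans hKt
  have hK' : (0 : ℝ) < K := by exact_mod_cast hK
  have hKt' : (K : ℝ) ≤ t := by exact_mod_cast hKt
  have hu : ∀ j, avgPrice p t j ∈ Set.Icc M.pMin M.pMax := fun j =>
    avgPrice_mem ht fun s hs => hp s hs j
  set E₀ := ∑ s ∈ Finset.Icc 1 t, e s i with hE₀
  set E₁ := ∑ s ∈ Finset.Icc 1 t, p s i * e s i with hE₁
  have h2 : ∑ s ∈ Finset.Icc 1 t, (p s i - avgPrice p t i) * e s i = E₁ - avgPrice p t i * E₀ := by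
    rw [hE₀, hE₁, Finset.mul_sum, ← Finset.sum_sub_distrib]
    exact Finset.sum_congr rfl fun s _ => by ring
  have hreg : M.regPosted v (empMoments K p t) i =
      M.regPrice (M.slopeFloor v) (avgPrice p t i) (expectedDemand M (avgPrice p t) i)
        (coMoment p t i i / K)
        (M.b * (coMoment p t i i / K) - M.c * (othersMean (coMoment p t i) i / K)) := by
    have hclip : (fun j => M.clip ((empMoments K p t).1 j)) = avgPrice p t :=
      funext fun j => M.clip_of_mem (hu j)
    have hclip' : M.clip ((empMoments K p t).1 i) = avgPrice p t i := M.clip_of_mem (hu i)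
    unfold Market.regPosted
    rw [hclip, hclip', ← othersMean_div]
    have : max ((empMoments K p t).2 i i) v = coMoment p t i i / K := max_eq_left hw
    rw [this]
    rfl
  rw [fittedPrice, avg_quantity_eq ht hq, sum_centered_mul_quantity_eq hq, h2, hreg]
  have e3 : (M.b * coMoment p t i i - M.c * othersMean (coMoment p t i) i -
        (E₁ - avgPrice p t i * E₀)) / K =
      M.b * (coMoment p t i i / K) - M.c * (othersMean (coMoment p t i) i / K) -
        (E₁ - avgPrice p t i * E₀) / K := by ring
  rw [e3]
  refine (hL _ _ _ _ _ _ (M.pMin_pos.le.trans (hu i).1) (M.le_expectedDemand hN hu i)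
    (M.expectedDemand_le hN hu i) hw).trans ?_
  rw [mul_assoc]
  refine mul_le_mul_of_nonneg_left ?_ hL0
  -- The perturbations of demand and slope are E₀ / t and (E₁ - ū E₀) / K, with ū the mean price; t
  -- ≥ K puts both on the scale 1 / K.
  have a1 : |E₀ / t| ≤ |E₀| / K := by
    rw [abs_div, Nat.abs_cast]
    gcongr
  have a2 : |(E₁ - avgPrice p t i * E₀) / K| ≤ |E₁| / K + M.pMax * (|E₀| / K) := by
    rw [abs_div, Nat.abs_cast, ← mul_div_assoc, ← add_div]
    gcongr
    refine (abs_sub _ _).trans ?_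
    rw [abs_mul]
    gcongr
    rw [abs_of_nonneg (M.pMin_pos.le.trans (hu i).1)]
    exact (hu i).2
  have a3 : 0 ≤ |E₁| / K := by positivity
  nlinarith [mul_nonneg hp0.le a3]

end Fitted

/-! ### Second moment bounds -/

section SecondMoments

variable {Ω : Type*} {m₀ : MeasurableSpace Ω} {Pr : Measure Ω} [IsProbabilityMeasure Pr]

/-- The variance of |X| is nonnegative. -/
lemma integral_abs_le_sqrt {X : Ω → ℝ} (hX : MemLp X 2 Pr) {B : ℝ} (hB : ∫ ω, X ω ^ 2 ∂Pr ≤ B) :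
    ∫ ω, |X ω| ∂Pr ≤ √B := by
  have h := variance_eq_sub (μ := Pr) hX.abs
  have h0 := variance_nonneg (fun ω => |X ω|) Pr
  have e : ∫ ω, ((fun ω => |X ω|) ^ 2) ω ∂Pr = ∫ ω, X ω ^ 2 ∂Pr := by simp
  refine Real.le_sqrt_of_sq_le ?_
  have h' : variance (fun ω => |X ω|) Pr = ∫ ω, X ω ^ 2 ∂Pr - (∫ ω, |X ω| ∂Pr) ^ 2 := by
    rw [← e]; exact h
  linarith

/-- The second moment of a sum of martingale differences. -/
lemma integral_sq_sum_martingaleDiff_le {𝓕 : ℕ → MeasurableSpace Ω} {n : ℕ} {D : ℕ → Ω → ℝ} {B : ℝ}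
    (hle : ∀ t ≤ n, 𝓕 t ≤ m₀) (hmono : Monotone 𝓕)
    (hmeas : ∀ s ∈ Finset.Icc 1 n, StronglyMeasurable[𝓕 s] (D s))
    (hL2 : ∀ s ∈ Finset.Icc 1 n, MemLp (D s) 2 Pr)
    (hzero : ∀ t < n, Pr[D (t + 1) | 𝓕 t] =ᵐ[Pr] 0)
    (hB : ∀ s ∈ Finset.Icc 1 n, ∫ ω, D s ω ^ 2 ∂Pr ≤ B) {t : ℕ} (ht : t ≤ n) :
    MemLp (fun ω => ∑ s ∈ Finset.Icc 1 t, D s ω) 2 Pr ∧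
      ∫ ω, (∑ s ∈ Finset.Icc 1 t, D s ω) ^ 2 ∂Pr ≤ t * B := by
  induction t with
  | zero => simp
  | succ t ih =>
    obtain ⟨ih1, ih2⟩ := ih (by omega)
    have hmem : t + 1 ∈ Finset.Icc 1 n := Finset.mem_Icc.2 ⟨by omega, ht⟩
    set S : Ω → ℝ := fun ω => ∑ s ∈ Finset.Icc 1 t, D s ω with hS
    have hSm : StronglyMeasurable[𝓕 t] S := by
      refine Finset.stronglyMeasurable_fun_sum _ fun s hs => ?_
      have hs' := Finset.mem_Icc.1 hs
      exact (hmeas s (Finset.mem_Icc.2 ⟨hs'.1, by omega⟩)).mono (hmono hs'.2)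
    have hsum : ∀ ω, ∑ s ∈ Finset.Icc 1 (t + 1), D s ω = S ω + D (t + 1) ω := fun ω =>
      Finset.sum_Icc_succ_top (by omega) _
    simp only [hsum]
    have hD := hL2 _ hmem
    refine ⟨ih1.add hD, ?_⟩
    have hint : Integrable (S * D (t + 1)) Pr := ih1.integrable_mul hD
    -- The past sum is measurable for 𝓕 t, so it factors out of the conditional expectation of the
    -- next difference, which vanishes.
    have hcross : ∫ ω, S ω * D (t + 1) ω ∂Pr = 0 := by
      have h1 := condExp_mul_of_stronglyMeasurable_left (μ := Pr) hSm hint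
        (hD.integrable one_le_two)
      have h2 : Pr[S * D (t + 1) | 𝓕 t] =ᵐ[Pr] 0 := by
        filter_upwards [h1, hzero t (by omega)] with ω h1 h2
        rw [h1, Pi.mul_apply, h2]
        simp
      have h3 := integral_condExp (μ := Pr) (f := S * D (t + 1)) (hle t (by omega))
      rw [integral_congr_ae h2] at h3
      simpa using h3.symm
    have e : ∀ ω, (S ω + D (t + 1) ω) ^ 2 = S ω ^ 2 + D (t + 1) ω ^ 2 + 2 * (S ω * D (t + 1) ω) :=
      fun ω => by ring
    simp only [e]
    have i1 := ih1.integrable_sq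
    have i2 := hD.integrable_sq
    have i3 : Integrable (fun ω => 2 * (S ω * D (t + 1) ω)) Pr := hint.const_mul 2
    rw [integral_add (f := fun ω => S ω ^ 2 + D (t + 1) ω ^ 2) (i1.add i2) i3, integral_add i1 i2, integral_const_mul, hcross]
    push_cast
    linarith [hB _ hmem]

/-- The weak law of large numbers in mean square. -/
lemma integral_sq_average_le {E : Type*} [MeasurableSpace E] {D : Measure E} {K : ℕ} (hK : 1 ≤ K)
    {X : ℕ → Ω → E} (hmeas : ∀ t ∈ Finset.Icc 1 K, Measurable (X t))
    (hindep : iIndepFun (fun (t : Finset.Icc 1 K) ω => X t ω) Pr)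
    (hlaw : ∀ t ∈ Finset.Icc 1 K, Pr.map (X t) = D) {f : E → ℝ} (hf : Measurable f) {B : ℝ}
    (hB : ∀ᵐ x ∂D, |f x| ≤ B) :
    MemLp (fun ω => (∑ t ∈ Finset.Icc 1 K, f (X t ω)) / K - ∫ x, f x ∂D) 2 Pr ∧
      ∫ ω, ((∑ t ∈ Finset.Icc 1 K, f (X t ω)) / K - ∫ x, f x ∂D) ^ 2 ∂Pr ≤ B ^ 2 / K := by
  have hK' : (0 : ℝ) < K := by exact_mod_cast hK
  have hbd : ∀ t ∈ Finset.Icc 1 K, ∀ᵐ ω ∂Pr, |f (X t ω)| ≤ B := by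
    intro t ht
    have := hB
    rw [← hlaw t ht] at this
    exact ae_of_ae_map (hmeas t ht).aemeasurable this
  have hL2 : ∀ t ∈ Finset.Icc 1 K, MemLp (fun ω => f (X t ω)) 2 Pr := fun t ht =>
    MemLp.of_bound (hf.comp (hmeas t ht)).aestronglyMeasurable B (hbd t ht)
  have hmean : ∀ t ∈ Finset.Icc 1 K, ∫ ω, f (X t ω) ∂Pr = ∫ x, f x ∂D := by
    intro t ht
    rw [← hlaw t ht, integral_map (hmeas t ht).aemeasurable hf.aestronglyMeasurable]
  set c := ∫ x, f x ∂D with hc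
  have hsumL2 : MemLp (fun ω => ∑ t ∈ Finset.Icc 1 K, f (X t ω)) 2 Pr := memLp_finsetSum _ hL2
  have hmem : MemLp (fun ω => (∑ t ∈ Finset.Icc 1 K, f (X t ω)) / K - c) 2 Pr := by
    have := (hsumL2.const_mul (1 / (K : ℝ))).sub (memLp_const (μ := Pr) (p := 2) c)
    refine this.ae_eq (ae_of_all _ fun ω => ?_)
    simp only [Pi.sub_apply]
    ring
  refine ⟨hmem, ?_⟩
  have hvar : variance (∑ t : Finset.Icc 1 K, fun ω => f (X t ω)) Pr ≤ K * B ^ 2 := by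
    rw [IndepFun.variance_sum (X := fun (t : Finset.Icc 1 K) ω => f (X t ω)) (fun t _ => hL2 t t.2)
      (fun s _ t _ hst => (hindep.indepFun hst).comp hf hf)]
    have h1 : ∀ t ∈ (Finset.univ : Finset (Finset.Icc 1 K)),
        variance (fun ω => f (X t ω)) Pr ≤ B ^ 2 := by
      intro t _
      refine (variance_le_expectation_sq (hL2 t t.2).1).trans ?_
      have h2 : ∫ ω, ((fun ω => f (X t ω)) ^ 2) ω ∂Pr ≤ ∫ _, B ^ 2 ∂Pr := by
        refine integral_mono_ae (hL2 t t.2).integrable_sq (integrable_const _) ?_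
        filter_upwards [hbd t t.2] with ω hω
        simp only [Pi.pow_apply]
        exact sq_le_sq' (abs_le.1 hω).1 (abs_le.1 hω).2
      simpa using h2
    refine (Finset.sum_le_card_nsmul _ _ _ h1).trans (le_of_eq ?_)
    simp
  have hsumeq : (∑ t : Finset.Icc 1 K, fun ω => f (X t ω)) =
      fun ω => ∑ t ∈ Finset.Icc 1 K, f (X t ω) := by
    funext ω
    rw [Finset.sum_apply]
    exact Finset.sum_coe_sort (Finset.Icc 1 K) fun t => f (X t ω)
  rw [hsumeq, variance_eq_integral hsumL2.1.aemeasurable,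
    integral_finsetSum _ (fun t ht => (hL2 t ht).integrable one_le_two),
    Finset.sum_congr rfl hmean, Finset.sum_const, Nat.card_Icc, nsmul_eq_mul,
    add_tsub_cancel_right] at hvar
  have e : ∀ ω, ((∑ t ∈ Finset.Icc 1 K, f (X t ω)) / K - c) ^ 2 =
      (1 / (K : ℝ) ^ 2) * (∑ t ∈ Finset.Icc 1 K, f (X t ω) - K * c) ^ 2 := by
    intro ω
    field_simp
  simp only [e]
  rw [integral_const_mul]
  calc _ ≤ 1 / (K : ℝ) ^ 2 * (K * B ^ 2) := by gcongr
    _ = B ^ 2 / K := by field_simp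

end SecondMoments

/-! ### Demand shocks in a pricing process -/

section Shocks

variable {N : ℕ} {Ω : Type*}

lemma history_mono (P Q : ℕ → Fin N → Ω → ℝ) : Monotone (history P Q) := by
  intro s t hst
  refine iSup₂_le fun r hr => ?_
  have hr' := Finset.mem_Icc.1 hr
  exact le_iSup₂ (f := fun (r : ℕ) (_ : r ∈ Finset.Icc 1 t) => ⨆ i : Fin N,
    MeasurableSpace.comap (P r i) inferInstance ⊔ MeasurableSpace.comap (Q r i) inferInstance)
    r (Finset.mem_Icc.2 ⟨hr'.1, hr'.2.trans hst⟩)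

lemma measurable_history (P Q : ℕ → Fin N → Ω → ℝ) {s t : ℕ} (hs : s ∈ Finset.Icc 1 t)
    (i : Fin N) : Measurable[history P Q t] (P s i) ∧ Measurable[history P Q t] (Q s i) := by
  have h : MeasurableSpace.comap (P s i) inferInstance ⊔
      MeasurableSpace.comap (Q s i) inferInstance ≤ history P Q t :=
    (le_iSup (fun i : Fin N => MeasurableSpace.comap (P s i) inferInstance ⊔
      MeasurableSpace.comap (Q s i) inferInstance) i).trans
    (le_iSup₂ (f := fun (r : ℕ) (_ : r ∈ Finset.Icc 1 t) => ⨆ i : Fin N,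
      MeasurableSpace.comap (P r i) inferInstance ⊔ MeasurableSpace.comap (Q r i) inferInstance)
      s hs)
  exact ⟨measurable_iff_comap_le.2 (le_sup_left.trans h),
    measurable_iff_comap_le.2 (le_sup_right.trans h)⟩

lemma measurable_othersMean {m : MeasurableSpace Ω} {p : Fin N → Ω → ℝ} (hp : ∀ j, Measurable (p j))
    (i : Fin N) : Measurable fun ω => othersMean (fun j => p j ω) i := by
  unfold othersMean
  exact (Finset.measurable_fun_sum _ fun j _ => hp j).div_const _

lemma measurable_fittedPrice (M : Market) {m : MeasurableSpace Ω} (K : ℕ)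
    {P Q : ℕ → Fin N → Ω → ℝ} {t : ℕ} (hP : ∀ s ∈ Finset.Icc 1 t, ∀ i, Measurable (P s i))
    (hQ : ∀ s ∈ Finset.Icc 1 t, ∀ i, Measurable (Q s i)) (i : Fin N) :
    Measurable fun ω => fittedPrice M K (fun s j => P s j ω) (fun s j => Q s j ω) t i := by
  have hu : Measurable fun ω => avgPrice (fun s j => P s j ω) t i :=
    (Finset.measurable_fun_sum _ fun s hs => hP s hs i).div_const _
  have hq : Measurable fun ω => (∑ s ∈ Finset.Icc 1 t, Q s i ω) / (t : ℝ) :=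
    (Finset.measurable_fun_sum _ fun s hs => hQ s hs i).div_const _
  have hw : Measurable fun ω => coMoment (fun s j => P s j ω) t i i / (K : ℝ) :=
    (Finset.measurable_fun_sum _ fun s hs =>
      ((hP s hs i).sub hu).mul ((hP s hs i).sub hu)).div_const _
  have hx : Measurable fun ω => -(∑ s ∈ Finset.Icc 1 t,
      (P s i ω - avgPrice (fun s j => P s j ω) t i) * Q s i ω) / (K : ℝ) :=
    (Finset.measurable_fun_sum _ fun s hs => ((hP s hs i).sub hu).mul (hQ s hs i)).neg.div_const _
  unfold fittedPrice Market.bestPrice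
  refine Measurable.ite (measurableSet_lt measurable_const hx) ?_ measurable_const
  exact M.measurable_clip.comp ((hu.div_const 2).add ((hq.mul hw).div (hx.const_mul 2)))

/-- The exploration price in exploration periods, and the price computed from the history in
exploitation periods. -/
def predictedPrice (M : Market) (K : ℕ) (P Q : ℕ → Fin N → Ω → ℝ) (s : ℕ) (i : Fin N) (ω : Ω) : ℝ :=
  if s ≤ K then P s i ω
  else fittedPrice M K (fun r j => P r j ω) (fun r j => Q r j ω) (s - 1) i

namespace IsPricingProcess

variable {m₀ : MeasurableSpace Ω} {M : Market} {D : Measure (Fin N → ℝ)} {K T : ℕ} {Pr : Measure Ω}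
  {P Q ε : ℕ → Fin N → Ω → ℝ}

lemma history_le (h : IsPricingProcess M D K T Pr P Q ε) {t : ℕ} (ht : t ≤ K + T) :
    history P Q t ≤ m₀ := by
  refine iSup₂_le fun s hs => iSup_le fun i => ?_
  have hs' : s ∈ Finset.Icc 1 (K + T) :=
    Finset.mem_Icc.2 ⟨(Finset.mem_Icc.1 hs).1, (Finset.mem_Icc.1 hs).2.trans ht⟩
  exact sup_le (measurable_iff_comap_le.1 (h.measurable_price s hs' i))
    (measurable_iff_comap_le.1 (h.measurable_quantity s hs' i))

/-- The history contains prices and quantities only, but the demand equation recovers the shock from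
them. -/
lemma measurable_shock (h : IsPricingProcess M D K T Pr P Q ε) {s : ℕ}
    (hs : s ∈ Finset.Icc 1 (K + T)) (i : Fin N) : Measurable[history P Q s] (ε s i) := by
  have hs1 : s ∈ Finset.Icc 1 s := Finset.mem_Icc.2 ⟨(Finset.mem_Icc.1 hs).1, le_rfl⟩
  have e : ε s i = fun ω => Q s i ω - expectedDemand M (fun j => P s j ω) i := by
    funext ω
    rw [h.demand s hs i ω]
    ring
  rw [e]
  refine (measurable_history P Q hs1 i).2.sub ?_
  unfold expectedDemand
  exact ((measurable_history P Q hs1 i).1.const_mul _).const_sub _ |>.add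
    ((measurable_othersMean (fun j => (measurable_history P Q hs1 j).1) i).const_mul _)

lemma measurable_predictedPrice {s : ℕ} (hs : 1 ≤ s) (i : Fin N) :
    Measurable[history P Q s] (predictedPrice M K P Q s i) := by
  unfold predictedPrice
  split_ifs with hK
  · exact (measurable_history P Q (Finset.mem_Icc.2 ⟨hs, le_rfl⟩) i).1
  · have hsub : ∀ r ∈ Finset.Icc 1 (s - 1), r ∈ Finset.Icc 1 s := fun r hr =>
      Finset.mem_Icc.2 ⟨(Finset.mem_Icc.1 hr).1, (Finset.mem_Icc.1 hr).2.trans (by omega)⟩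
    exact measurable_fittedPrice M K (m := history P Q s)
      (fun r hr j => (measurable_history P Q (hsub r hr) j).1)
      (fun r hr j => (measurable_history P Q (hsub r hr) j).2) i

lemma explore_mem (h : IsPricingProcess M D K T Pr P Q ε) (hD : IsExplorationLaw M D) {s : ℕ}
    (hs : s ∈ Finset.Icc 1 K) : ∀ᵐ ω ∂Pr, ∀ i, P s i ω ∈ Set.Icc M.pMin M.pMax := by
  have hs' : s ∈ Finset.Icc 1 (K + T) :=
    Finset.mem_Icc.2 ⟨(Finset.mem_Icc.1 hs).1, (Finset.mem_Icc.1 hs).2.trans (by omega)⟩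
  have hm : Measurable fun ω i => P s i ω := measurable_pi_lambda _ (h.measurable_price s hs')
  have := hD.support
  rw [← h.explore_law s hs] at this
  exact ae_of_ae_map hm.aemeasurable this

lemma abs_predictedPrice_le (h : IsPricingProcess M D K T Pr P Q ε) (hD : IsExplorationLaw M D)
    {s : ℕ} (hs : 1 ≤ s) (i : Fin N) : ∀ᵐ ω ∂Pr, |predictedPrice M K P Q s i ω| ≤ M.pMax := by
  unfold predictedPrice
  split_ifs with hK
  · filter_upwards [h.explore_mem hD (Finset.mem_Icc.2 ⟨hs, hK⟩)] with ω hω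
    rw [abs_of_nonneg (M.pMin_pos.le.trans (hω i).1)]
    exact (hω i).2
  · refine ae_of_all _ fun ω => ?_
    have := fittedPrice_mem M K (fun r j => P r j ω) (fun r j => Q r j ω) (s - 1) i
    rw [abs_of_nonneg (M.pMin_pos.le.trans this.1)]
    exact this.2

lemma memLp_weighted_shock (h : IsPricingProcess M D K T Pr P Q ε) (hD : IsExplorationLaw M D)
    {s : ℕ} (hs : s ∈ Finset.Icc 1 (K + T)) (i : Fin N) :
    MemLp (fun ω => predictedPrice M K P Q s i ω * ε s i ω) 2 Pr := by
  obtain ⟨hs1, hs2⟩ := Finset.mem_Icc.1 hs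
  refine (h.shock_memLp s hs i).of_le_mul (c := M.pMax) ?_ ?_
  · exact ((measurable_predictedPrice hs1 i).mul (h.measurable_shock hs i)).mono
      (h.history_le hs2) le_rfl |>.aestronglyMeasurable
  · filter_upwards [h.abs_predictedPrice_le hD hs1 i] with ω hω
    rw [norm_mul]
    gcongr
    exact hω

variable [IsProbabilityMeasure Pr]

lemma integral_sq_shock_le (h : IsPricingProcess M D K T Pr P Q ε) {s : ℕ}
    (hs : s ∈ Finset.Icc 1 (K + T)) (i : Fin N) : ∫ ω, ε s i ω ^ 2 ∂Pr ≤ M.σenv ^ 2 := by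
  obtain ⟨hs1, hs2⟩ := Finset.mem_Icc.1 hs
  obtain ⟨t, rfl⟩ : ∃ t, s = t + 1 := ⟨s - 1, by omega⟩
  rw [← integral_condExp (h.history_le (t := t) (by omega))]
  refine (integral_mono_ae integrable_condExp (integrable_const _)
    (h.shock_sq t (by omega) i)).trans ?_
  simp

lemma shock_sum_bound (h : IsPricingProcess M D K T Pr P Q ε) {t : ℕ} (ht : t ≤ K + T)
    (i : Fin N) :
    MemLp (fun ω => ∑ s ∈ Finset.Icc 1 t, ε s i ω) 2 Pr ∧
      ∫ ω, (∑ s ∈ Finset.Icc 1 t, ε s i ω) ^ 2 ∂Pr ≤ t * M.σenv ^ 2 :=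
  integral_sq_sum_martingaleDiff_le (𝓕 := history P Q) (D := fun s => ε s i)
    (fun _ ht => h.history_le ht) (history_mono P Q)
    (fun _ hs => (h.measurable_shock hs i).stronglyMeasurable)
    (fun s hs => h.shock_memLp s hs i) (fun t ht => h.shock_mean t ht i)
    (fun _ hs => h.integral_sq_shock_le hs i) ht

/-- The weights are `predictedPrice` rather than the posted prices because, when the least squares
fit is not unique, a posted price may depend on an arbitrary choice of fit and need not be a
function of the past. The fitted formula always is, and it is bounded. In exploration the martingale
property is the exogeneity assumption; afterwards the weight factors out. -/
lemma weighted_shock_sum_bound (h : IsPricingProcess M D K T Pr P Q ε)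
    (hD : IsExplorationLaw M D) {t : ℕ} (ht : t ≤ K + T) (i : Fin N) :
    MemLp (fun ω => ∑ s ∈ Finset.Icc 1 t, predictedPrice M K P Q s i ω * ε s i ω) 2 Pr ∧
      ∫ ω, (∑ s ∈ Finset.Icc 1 t, predictedPrice M K P Q s i ω * ε s i ω) ^ 2 ∂Pr ≤
        t * (M.pMax ^ 2 * M.σenv ^ 2) := by
  refine integral_sq_sum_martingaleDiff_le (𝓕 := history P Q)
    (D := fun s ω => predictedPrice M K P Q s i ω * ε s i ω)
    (fun _ ht => h.history_le ht) (history_mono P Q)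
    (fun s hs => ((measurable_predictedPrice (Finset.mem_Icc.1 hs).1 i).mul
      (h.measurable_shock hs i)).stronglyMeasurable)
    (fun s hs => h.memLp_weighted_shock hD hs i) ?_ ?_ ht
  · intro t ht
    have hmem : t + 1 ∈ Finset.Icc 1 (K + T) := Finset.mem_Icc.2 ⟨by omega, by omega⟩
    by_cases htK : t < K
    · have e : (fun ω => predictedPrice M K P Q (t + 1) i ω * ε (t + 1) i ω) =
          fun ω => P (t + 1) i ω * ε (t + 1) i ω := by
        funext ω
        rw [predictedPrice, if_pos (by omega)]
      rw [e]
      exact h.shock_exogenous t htK i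
    · have hm : StronglyMeasurable[history P Q t] (predictedPrice M K P Q (t + 1) i) := by
        have e : predictedPrice M K P Q (t + 1) i =
            fun ω => fittedPrice M K (fun r j => P r j ω) (fun r j => Q r j ω) t i := by
          funext ω
          rw [predictedPrice, if_neg (by omega), Nat.add_sub_cancel]
        rw [e]
        exact (measurable_fittedPrice M K (m := history P Q t)
          (fun r hr j => (measurable_history P Q hr j).1)
          (fun r hr j => (measurable_history P Q hr j).2) i).stronglyMeasurable
      have h1 := condExp_mul_of_stronglyMeasurable_left (μ := Pr) (g := ε (t + 1) i) hm
        ((h.memLp_weighted_shock hD hmem i).integrable one_le_two)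
        ((h.shock_memLp _ hmem i).integrable one_le_two)
      refine h1.trans ?_
      filter_upwards [h.shock_mean t ht i] with ω hω
      rw [Pi.mul_apply, hω]
      simp
  · intro s hs
    have h1 : ∫ ω, (predictedPrice M K P Q s i ω * ε s i ω) ^ 2 ∂Pr ≤
        ∫ ω, M.pMax ^ 2 * ε s i ω ^ 2 ∂Pr := by
      refine integral_mono_ae (h.memLp_weighted_shock hD hs i).integrable_sq
        ((h.shock_memLp s hs i).integrable_sq.const_mul _) ?_
      filter_upwards [h.abs_predictedPrice_le hD (Finset.mem_Icc.1 hs).1 i] with ω hω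
      rw [mul_pow]
      gcongr ?_ * _
      exact sq_le_sq' (abs_le.1 hω).1 (abs_le.1 hω).2
    refine h1.trans ?_
    rw [integral_const_mul]
    gcongr
    exact h.integral_sq_shock_le hs i

end IsPricingProcess

end Shocks

/-! ### The exploration law -/

namespace IsExplorationLaw

variable {N : ℕ} {M : Market} {D : Measure (Fin N → ℝ)}

lemma ae_abs_le (hD : IsExplorationLaw M D) (i : Fin N) : ∀ᵐ x ∂D, |x i| ≤ M.pMax := by
  filter_upwards [hD.support] with x hx
  rw [abs_of_nonneg (M.pMin_pos.le.trans (hx i).1)]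
  exact (hx i).2

lemma ae_abs_mul_le (hD : IsExplorationLaw M D) (i j : Fin N) :
    ∀ᵐ x ∂D, |x i * x j| ≤ M.pMax ^ 2 := by
  filter_upwards [hD.ae_abs_le i, hD.ae_abs_le j] with x hi hj
  rw [abs_mul, sq]
  exact mul_le_mul hi hj (abs_nonneg _) M.pMax_pos.le

lemma memLp_coord (hD : IsExplorationLaw M D) (i : Fin N) :
    MemLp (fun x : Fin N → ℝ => x i) 2 D := by
  have := hD.isProbabilityMeasure
  exact MemLp.of_bound (measurable_pi_apply i).aestronglyMeasurable M.pMax (hD.ae_abs_le i)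

lemma explorationMean_mem (hD : IsExplorationLaw M D) (i : Fin N) :
    explorationMean D i ∈ Set.Icc M.pMin M.pMax := by
  have := hD.isProbabilityMeasure
  have hint := (hD.memLp_coord i).integrable one_le_two
  constructor
  · have := integral_mono_ae (integrable_const M.pMin) hint
      (by filter_upwards [hD.support] with x hx using (hx i).1)
    simpa [explorationMean] using this
  · have := integral_mono_ae hint (integrable_const M.pMax)
      (by filter_upwards [hD.support] with x hx using (hx i).2)
    simpa [explorationMean] using this

lemma explorationCov_eq (hD : IsExplorationLaw M D) (i j : Fin N) :
    explorationCov D i j = ∫ x, x i * x j ∂D - explorationMean D i * explorationMean D j := by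
  have := hD.isProbabilityMeasure
  exact covariance_eq_sub (hD.memLp_coord i) (hD.memLp_coord j)

lemma explorationCov_self_pos (hD : IsExplorationLaw M D) (i : Fin N) :
    0 < explorationCov D i i := by
  have h := hD.variance_pos i
  rwa [← covariance_self (measurable_pi_apply i).aemeasurable] at h

/-- The factor 2 lets the empirical variances deviate by v and still be at least v. -/
lemma exists_variance_floor (hD : IsExplorationLaw M D) :
    ∃ v : ℝ, 0 < v ∧ ∀ i, 2 * v ≤ explorationCov D i i := by
  rcases isEmpty_or_nonempty (Fin N) with h | h
  · exact ⟨1, one_pos, fun i => h.elim i⟩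
  · obtain ⟨i, hi⟩ := Finite.exists_min fun i => explorationCov D i i
    exact ⟨explorationCov D i i / 2, half_pos (hD.explorationCov_self_pos i),
      fun j => by linarith [hi j]⟩

end IsExplorationLaw

/-! ### Deviations of a pricing process from its limit -/

section Deviation

variable {N : ℕ}

/-- A bound for the deviation of the empirical moments of the exploration phase. -/
def initError (M : Market) (D : Measure (Fin N → ℝ)) (K : ℕ) (p : ℕ → Fin N → ℝ) : ℝ :=
  (1 + 2 * M.pMax) * ∑ i, |(∑ s ∈ Finset.Icc 1 K, p s i) / K - ∫ x, x i ∂D| +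
    ∑ i, ∑ j, |(∑ s ∈ Finset.Icc 1 K, p s i * p s j) / K - ∫ x, x i * x j ∂D|

/-- The normalized sums of the demand shocks, unweighted and weighted with `w`. -/
def shockError (K : ℕ) (e w : ℕ → Fin N → ℝ) (t : ℕ) : ℝ :=
  ∑ i, (|∑ s ∈ Finset.Icc 1 t, e s i| / K + |∑ s ∈ Finset.Icc 1 t, w s i * e s i| / K)

lemma shockError_nonneg (K : ℕ) (e w : ℕ → Fin N → ℝ) (t : ℕ) : 0 ≤ shockError K e w t :=
  Finset.sum_nonneg fun i _ => by positivity

lemma initError_nonneg (M : Market) (D : Measure (Fin N → ℝ)) (K : ℕ) (p : ℕ → Fin N → ℝ) :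
    0 ≤ initError M D K p := by
  have := M.pMax_pos
  unfold initError
  positivity

lemma norm_empMoments_sub_le {M : Market} {D : Measure (Fin N → ℝ)} (hD : IsExplorationLaw M D)
    {K : ℕ} (hK : 1 ≤ K) {p : ℕ → Fin N → ℝ}
    (hp : ∀ s ∈ Finset.Icc 1 K, ∀ i, p s i ∈ Set.Icc M.pMin M.pMax) :
    ‖empMoments K p K - ((explorationMean D, explorationCov D) : Moments N)‖ ≤
      initError M D K p := by
  have hp0 := M.pMax_pos
  have hK' : (0 : ℝ) < K := by exact_mod_cast hK
  set A := ∑ i, |(∑ s ∈ Finset.Icc 1 K, p s i) / K - ∫ x, x i ∂D| with hA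
  set B := ∑ i, ∑ j, |(∑ s ∈ Finset.Icc 1 K, p s i * p s j) / K - ∫ x, x i * x j ∂D| with hB
  have hA1 : ∀ i, |avgPrice p K i - explorationMean D i| ≤ A := fun i =>
    Finset.single_le_sum (f := fun i => |(∑ s ∈ Finset.Icc 1 K, p s i) / K - ∫ x, x i ∂D|)
      (fun _ _ => abs_nonneg _) (Finset.mem_univ i)
  have hB1 : ∀ i j, |(∑ s ∈ Finset.Icc 1 K, p s i * p s j) / K - ∫ x, x i * x j ∂D| ≤ B := by
    intro i j
    refine (Finset.single_le_sum
      (f := fun j => |(∑ s ∈ Finset.Icc 1 K, p s i * p s j) / K - ∫ x, x i * x j ∂D|)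
      (fun _ _ => abs_nonneg _) (Finset.mem_univ j)).trans ?_
    exact Finset.single_le_sum
      (f := fun i => ∑ j, |(∑ s ∈ Finset.Icc 1 K, p s i * p s j) / K - ∫ x, x i * x j ∂D|)
      (fun _ _ => Finset.sum_nonneg fun _ _ => abs_nonneg _) (Finset.mem_univ i)
  have hA0 : 0 ≤ A := Finset.sum_nonneg fun _ _ => abs_nonneg _
  have hB0 : 0 ≤ B := Finset.sum_nonneg fun _ _ => Finset.sum_nonneg fun _ _ => abs_nonneg _
  have hpA : 0 ≤ M.pMax * A := by positivity
  refine Market.norm_moments_le (initError_nonneg M D K p) (fun i => ?_) fun i j => ?_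
  · refine (hA1 i).trans ?_
    unfold initError
    rw [← hA, ← hB]
    linarith
  -- Covariance is mean product minus product of means; the latter is telescoped, and each of the
  -- two pieces costs `pMax` times a mean error. This explains the weight 1 + 2 `pMax` in
  -- `initError`.
  · have e : (empMoments K p K - ((explorationMean D, explorationCov D) : Moments N)).2 i j =
        ((∑ s ∈ Finset.Icc 1 K, p s i * p s j) / K - ∫ x, x i * x j ∂D) -
        (avgPrice p K i * (avgPrice p K j - explorationMean D j) +
          (avgPrice p K i - explorationMean D i) * explorationMean D j) := by
      have h1 : (empMoments K p K - ((explorationMean D, explorationCov D) : Moments N)).2 i j =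
        coMoment p K i j / K - explorationCov D i j := rfl
      rw [h1, coMoment_eq, hD.explorationCov_eq]
      field_simp
      ring
    rw [e]
    have hu : ∀ i, |avgPrice p K i| ≤ M.pMax := fun i => by
      have := avgPrice_mem hK fun s hs => hp s hs i
      rw [abs_of_nonneg (M.pMin_pos.le.trans this.1)]
      exact this.2
    have hm : ∀ i, |explorationMean D i| ≤ M.pMax := fun i => by
      have := hD.explorationMean_mem i
      rw [abs_of_nonneg (M.pMin_pos.le.trans this.1)]
      exact this.2
    have a1 : |avgPrice p K i * (avgPrice p K j - explorationMean D j)| ≤ M.pMax * A := by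
      rw [abs_mul]
      exact mul_le_mul (hu i) (hA1 j) (abs_nonneg _) hp0.le
    have a2 : |(avgPrice p K i - explorationMean D i) * explorationMean D j| ≤ A * M.pMax := by
      rw [abs_mul]
      exact mul_le_mul (hA1 i) (hm j) (abs_nonneg _) hA0
    refine (abs_sub _ _).trans ((add_le_add (hB1 i j)
      ((abs_add_le _ _).trans (add_le_add a1 a2))).trans ?_)
    unfold initError
    rw [← hA, ← hB]
    linarith

end Deviation

namespace IsPricingProcess

variable {N : ℕ} {M : Market} {D : Measure (Fin N → ℝ)} {Ω : Type*} {m₀ : MeasurableSpace Ω}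
  {K T : ℕ} {Pr : Measure Ω} {P Q ε : ℕ → Fin N → Ω → ℝ}

/-- Almost surely prices are feasible, and in exploitation periods they are the fitted prices as
long as the exploration prices are not degenerate. -/
lemma ae_price_eq (h : IsPricingProcess M D K T Pr P Q ε) (hD : IsExplorationLaw M D)
    (hK : 1 ≤ K) :
    ∀ᵐ ω ∂Pr, (∀ t ∈ Finset.Icc 1 (K + T), ∀ i, P t i ω ∈ Set.Icc M.pMin M.pMax) ∧
      ∀ i, 0 < coMoment (fun s j => P s j ω) K i i → ∀ t, K ≤ t → t < K + T →
        P (t + 1) i ω = fittedPrice M K (fun s j => P s j ω) (fun s j => Q s j ω) t i := by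
  have h1 : ∀ᵐ ω ∂Pr, ∀ s ∈ Finset.Icc 1 K, ∀ i, P s i ω ∈ Set.Icc M.pMin M.pMax :=
    (Finset.eventually_all _).2 fun s hs => h.explore_mem hD hs
  have h2 : ∀ᵐ ω ∂Pr, ∀ s ∈ Finset.Icc 1 (K + T), ∀ i, 0 < Q s i ω :=
    (Finset.eventually_all _).2 fun s hs => eventually_all.2 fun i => h.quantity_pos s hs i
  have h3 : ∀ᵐ ω ∂Pr, ∀ t ∈ Finset.Ico K (K + T), ∀ i, ∃ α β : ℝ,
      IsOLSFit (fun s => P s i ω) (fun s => Q s i ω) t α β ∧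
      P (t + 1) i ω ∈ Set.Icc M.pMin M.pMax ∧
      IsMaxOn (fun p : ℝ => p * (α + β * p)) (Set.Icc M.pMin M.pMax) (P (t + 1) i ω) :=
    (Finset.eventually_all _).2 fun t ht => eventually_all.2 fun i =>
      h.exploit t (Finset.mem_Ico.1 ht).1 (Finset.mem_Ico.1 ht).2 i
  filter_upwards [h1, h2, h3] with ω h1 h2 h3
  have hbox : ∀ t ∈ Finset.Icc 1 (K + T), ∀ i, P t i ω ∈ Set.Icc M.pMin M.pMax := by
    intro t ht i
    obtain ⟨ht1, ht2⟩ := Finset.mem_Icc.1 ht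
    by_cases htK : t ≤ K
    · exact h1 t (Finset.mem_Icc.2 ⟨ht1, htK⟩) i
    · obtain ⟨r, rfl⟩ : ∃ r, t = r + 1 := ⟨t - 1, by omega⟩
      obtain ⟨α, β, -, h', -⟩ := h3 r (Finset.mem_Ico.2 ⟨by omega, by omega⟩) i
      exact h'
  refine ⟨hbox, ?_⟩
  intro i hpos t hKt htT
  have hsub : ∀ s ∈ Finset.Icc 1 t, s ∈ Finset.Icc 1 (K + T) := fun s hs =>
    Finset.mem_Icc.2 ⟨(Finset.mem_Icc.1 hs).1, (Finset.mem_Icc.1 hs).2.trans htT.le⟩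
  exact eq_fittedPrice (p := fun s j => P s j ω) (q := fun s j => Q s j ω) hK (hK.trans hKt)
    (fun s hs => hbox s (hsub s hs) i) (fun s hs => h2 s (hsub s hs) i)
    (hpos.trans_le (coMoment_self_mono _ i hKt)) (h3 t (Finset.mem_Ico.2 ⟨hKt, htT⟩) i)

variable [IsProbabilityMeasure Pr]

/-- The mean-square law of large numbers is applied to the bounded functions x i and x i * x j of
the i.i.d. exploration prices. -/
lemma initError_bound (h : IsPricingProcess M D K T Pr P Q ε) (hD : IsExplorationLaw M D)
    (hK : 1 ≤ K) :
    Integrable (fun ω => initError M D K fun s i => P s i ω) Pr ∧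
      ∫ ω, initError M D K (fun s i => P s i ω) ∂Pr ≤
        ((1 + 2 * M.pMax) * (N * M.pMax) + N * (N * M.pMax ^ 2)) / √K := by
  have hp0 := M.pMax_pos
  have hmeas : ∀ t ∈ Finset.Icc 1 K, Measurable fun ω i => P t i ω := fun t ht =>
    measurable_pi_lambda _ (h.measurable_price t
      (Finset.mem_Icc.2 ⟨(Finset.mem_Icc.1 ht).1, (Finset.mem_Icc.1 ht).2.trans (by omega)⟩))
  have h1 := fun i => integral_sq_average_le hK hmeas h.explore_indep h.explore_law
    (f := fun x : Fin N → ℝ => x i) (measurable_pi_apply i) (hD.ae_abs_le i)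
  have h2 := fun i j => integral_sq_average_le hK hmeas h.explore_indep h.explore_law
    (f := fun x : Fin N → ℝ => x i * x j) ((measurable_pi_apply i).mul (measurable_pi_apply j))
    (hD.ae_abs_mul_le i j)
  have hs : ∀ B : ℝ, 0 ≤ B → √(B ^ 2 / K) = B / √K := fun B hB => by
    rw [Real.sqrt_div (sq_nonneg B), Real.sqrt_sq hB]
  have b1 := fun i => (integral_abs_le_sqrt (h1 i).1 (h1 i).2).trans_eq (hs _ hp0.le)
  have b2 := fun i j => (integral_abs_le_sqrt (h2 i j).1 (h2 i j).2).trans_eq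
    (hs _ (by positivity))
  have i1 := fun i => ((h1 i).1.integrable one_le_two).abs
  have i2 := fun i j => ((h2 i j).1.integrable one_le_two).abs
  have i1' := integrable_finsetSum Finset.univ fun i _ => i1 i
  have i2' := integrable_finsetSum Finset.univ fun i _ =>
    integrable_finsetSum Finset.univ fun j _ => i2 i j
  unfold initError
  refine ⟨(i1'.const_mul _).add i2', ?_⟩
  rw [integral_add (i1'.const_mul _) i2', integral_const_mul,
    integral_finsetSum _ fun i _ => i1 i,
    integral_finsetSum _ fun i _ => integrable_finsetSum Finset.univ fun j _ => i2 i j]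
  have s1 := Finset.sum_le_card_nsmul Finset.univ _ _ fun i _ => b1 i
  have s2 : ∀ i : Fin N, ∫ ω, ∑ j, |(∑ s ∈ Finset.Icc 1 K, P s i ω * P s j ω) / K -
      ∫ x, x i * x j ∂D| ∂Pr ≤ N * (M.pMax ^ 2 / √K) := by
    intro i
    rw [integral_finsetSum _ fun j _ => i2 i j]
    refine (Finset.sum_le_card_nsmul Finset.univ _ _ fun j _ => b2 i j).trans (le_of_eq ?_)
    simp
  have s3 := Finset.sum_le_card_nsmul Finset.univ _ _ fun i _ => s2 i
  rw [Finset.card_univ, Fintype.card_fin, nsmul_eq_mul] at s1 s3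
  have e : ((1 + 2 * M.pMax) * (N * M.pMax) + N * (N * M.pMax ^ 2)) / √K =
      (1 + 2 * M.pMax) * (N * (M.pMax / √K)) + N * (N * (M.pMax ^ 2 / √K)) := by ring
  rw [e]
  have := mul_le_mul_of_nonneg_left s1 (by positivity : 0 ≤ 1 + 2 * M.pMax)
  linarith

/-- A martingale sum over t ≤ S K periods has L¹ norm O(√(S K)), and division by K leaves O(√S /
√K). -/
lemma shockError_bound (h : IsPricingProcess M D K T Pr P Q ε) (hD : IsExplorationLaw M D)
    (hK : 1 ≤ K) {S : ℝ} {t : ℕ} (ht : t ≤ K + T) (htS : (t : ℝ) ≤ S * K) :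
    Integrable (fun ω => shockError K (fun s i => ε s i ω)
        (fun s i => predictedPrice M K P Q s i ω) t) Pr ∧
      ∫ ω, shockError K (fun s i => ε s i ω)
        (fun s i => predictedPrice M K P Q s i ω) t ∂Pr ≤
        N * ((1 + M.pMax) * |M.σenv| * √S) / √K := by
  have hp0 := M.pMax_pos
  have hK' : (0 : ℝ) < K := by exact_mod_cast hK
  have h1 := fun i => h.shock_sum_bound ht i
  have h2 := fun i => h.weighted_shock_sum_bound hD ht i
  have hs : ∀ B : ℝ, √(t * B ^ 2) / K ≤ |B| * √S / √K := by
    intro B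
    have hS : √(t * B ^ 2) ≤ √S * √K * |B| := by
      rw [← Real.sqrt_sq_eq_abs, ← Real.sqrt_mul' _ hK'.le, ← Real.sqrt_mul' _ (sq_nonneg B)]
      exact Real.sqrt_le_sqrt (mul_le_mul_of_nonneg_right htS (sq_nonneg B))
    have hsK : 0 < √(K : ℝ) := Real.sqrt_pos.2 hK'
    rw [div_le_div_iff₀ hK' hsK]
    calc √(t * B ^ 2) * √K ≤ √S * √K * |B| * √K := by gcongr
      _ = |B| * √S * (√K * √K) := by ring
      _ = |B| * √S * K := by rw [Real.mul_self_sqrt hK'.le]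
  have b1 : ∀ i, ∫ ω, |∑ s ∈ Finset.Icc 1 t, ε s i ω| / K ∂Pr ≤ |M.σenv| * √S / √K := by
    intro i
    rw [integral_div]
    refine le_trans ?_ (hs M.σenv)
    gcongr
    exact integral_abs_le_sqrt (h1 i).1 (h1 i).2
  have b2 : ∀ i, ∫ ω, |∑ s ∈ Finset.Icc 1 t, predictedPrice M K P Q s i ω * ε s i ω| / K ∂Pr ≤
      M.pMax * |M.σenv| * √S / √K := by
    intro i
    rw [integral_div]
    have h3 := hs (M.pMax * M.σenv)
    rw [abs_mul, abs_of_pos hp0, mul_pow] at h3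
    refine le_trans ?_ h3
    gcongr
    exact integral_abs_le_sqrt (h2 i).1 (h2 i).2
  have i1 := fun i => (((h1 i).1.integrable one_le_two).abs).div_const (K : ℝ)
  have i2 := fun i => (((h2 i).1.integrable one_le_two).abs).div_const (K : ℝ)
  have i3 : ∀ i, Integrable (fun ω => |∑ s ∈ Finset.Icc 1 t, ε s i ω| / K +
      |∑ s ∈ Finset.Icc 1 t, predictedPrice M K P Q s i ω * ε s i ω| / K) Pr :=
    fun i => (i1 i).add (i2 i)
  unfold shockError
  refine ⟨integrable_finsetSum _ fun i _ => i3 i, ?_⟩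
  rw [integral_finsetSum _ fun i _ => i3 i]
  have b3 : ∀ i : Fin N, ∫ ω, (|∑ s ∈ Finset.Icc 1 t, ε s i ω| / K +
      |∑ s ∈ Finset.Icc 1 t, predictedPrice M K P Q s i ω * ε s i ω| / K) ∂Pr ≤
      (1 + M.pMax) * |M.σenv| * √S / √K := by
    intro i
    rw [integral_add (i1 i) (i2 i)]
    refine (add_le_add (b1 i) (b2 i)).trans (le_of_eq ?_)
    ring
  refine (Finset.sum_le_card_nsmul Finset.univ _ _ fun i _ => b3 i).trans (le_of_eq ?_)
  rw [Finset.card_univ, Fintype.card_fin, nsmul_eq_mul]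
  ring

end IsPricingProcess

/-! ### Convergence in probability -/

/-- The last price of a pricing process is close to the price map along the price-moments ODE, up
to a random error whose mean is of order `1 / √K`. -/
theorem exists_pricing_deviation_bound {N : ℕ} (hN : 2 ≤ N) {M : Market}
    {D : Measure (Fin N → ℝ)} (hD : IsExplorationLaw M D) {v : ℝ} (hv : 0 < v)
    (hvD : ∀ i, 2 * v ≤ explorationCov D i i) {z : ℝ → Moments N}
    (hz1 : z 1 = (explorationMean D, explorationCov D))
    (hz : ∀ s, 1 ≤ s → HasDerivWithinAt z (M.field v s (z s)) (Set.Ici 1) s)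
    {S : ℝ} (hS : 0 ≤ S) :
    ∃ C : ℝ, 0 ≤ C ∧ ∀ {Ω : Type*} [MeasurableSpace Ω] (Pr : Measure Ω) [IsProbabilityMeasure Pr]
      (P Q ε : ℕ → Fin N → Ω → ℝ) (K n : ℕ), 1 ≤ K → K ≤ n → (n : ℝ) ≤ S * K →
      ∀ T, K + T = n + 1 → IsPricingProcess M D K T Pr P Q ε →
      ∃ X : Ω → ℝ, Integrable X Pr ∧ (∀ ω, 0 ≤ X ω) ∧ ∫ ω, X ω ∂Pr ≤ C / √K ∧
        ∀ᵐ ω ∂Pr, X ω < v → ∀ i,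
          |P (n + 1) i ω - M.regPosted v (z (n / K)) i| ≤ C * (X ω + 1 / K) := by
  have hp0 := M.pMax_pos
  obtain ⟨L, hL0, hL⟩ := exists_fittedPrice_bound M hN hv
  obtain ⟨C₁, hC₁0, hC₁⟩ := exists_price_deviation_bound (M := M) hN hv S
  set c₀ := (1 + 2 * M.pMax) * (N * M.pMax) + N * (N * M.pMax ^ 2) with hc₀
  set c₁ := N * ((1 + M.pMax) * |M.σenv| * √S) with hc₁
  have hc₀0 : 0 ≤ c₀ := by positivity
  have hc₁0 : 0 ≤ c₁ := by positivity
  refine ⟨(c₀ + S * c₁ + c₁) + C₁ * (1 + L), by positivity, ?_⟩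
  intro Ω _ Pr _ P Q ε K n hK hKn hnS T hT h
  have hK' : (0 : ℝ) < K := by exact_mod_cast hK
  set J : Ω → ℝ := fun ω => initError M D K fun s i => P s i ω with hJ
  set E : ℕ → Ω → ℝ := fun t ω => shockError K (fun s i => ε s i ω)
    (fun s i => predictedPrice M K P Q s i ω) t with hE
  have hJ0 : ∀ ω, 0 ≤ J ω := fun ω => initError_nonneg _ _ _ _
  have hE0 : ∀ t ω, 0 ≤ E t ω := fun t ω => shockError_nonneg _ _ _ _
  obtain ⟨hJi, hJb⟩ := h.initError_bound hD hK
  have hEb : ∀ t ≤ n, Integrable (E t) Pr ∧ ∫ ω, E t ω ∂Pr ≤ c₁ / √K := fun t ht =>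
    h.shockError_bound hD hK (S := S) (by omega)
      (le_trans (by exact_mod_cast ht) hnS)
  have hEi : ∀ t ∈ Finset.Ico K n, Integrable (E t) Pr := fun t ht =>
    (hEb t (Finset.mem_Ico.1 ht).2.le).1
  have hsumi : Integrable (fun ω => (∑ t ∈ Finset.Ico K n, E t ω) / K) Pr :=
    (integrable_finsetSum _ hEi).div_const _
  have hA0 : ∀ ω, 0 ≤ (∑ t ∈ Finset.Ico K n, E t ω) / (K : ℝ) := fun ω =>
    div_nonneg (Finset.sum_nonneg fun t _ => hE0 t ω) hK'.le
  have hJAi : Integrable (fun ω => J ω + (∑ t ∈ Finset.Ico K n, E t ω) / K) Pr := hJi.add hsumi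
  -- The three error sources of the Grönwall bound: initial moments, time-averaged shocks, and the
  -- shocks entering the last fit.
  refine ⟨fun ω => J ω + (∑ t ∈ Finset.Ico K n, E t ω) / K + E n ω,
    hJAi.add (hEb n le_rfl).1, fun ω => by linarith [hJ0 ω, hA0 ω, hE0 n ω], ?_, ?_⟩
  · rw [integral_add hJAi (hEb n le_rfl).1, integral_add hJi hsumi, integral_div,
      integral_finsetSum _ hEi]
    have hsumb : (∑ t ∈ Finset.Ico K n, ∫ ω, E t ω ∂Pr) / (K : ℝ) ≤ S * (c₁ / √K) := by
      rw [div_le_iff₀ hK']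
      refine (Finset.sum_le_card_nsmul _ _ _ fun t ht =>
        (hEb t (Finset.mem_Ico.1 ht).2.le).2).trans ?_
      rw [Nat.card_Ico, nsmul_eq_mul]
      have h1 : ((n - K : ℕ) : ℝ) ≤ S * K :=
        le_trans (by exact_mod_cast Nat.sub_le n K) hnS
      calc ((n - K : ℕ) : ℝ) * (c₁ / √K) ≤ S * K * (c₁ / √K) := by gcongr
        _ = _ := by ring
    have e : (c₀ + S * c₁ + c₁ + C₁ * (1 + L)) / √(K : ℝ) =
        c₀ / √K + S * (c₁ / √K) + c₁ / √K + C₁ * (1 + L) / √K := by ring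
    rw [e]
    have h2 : 0 ≤ C₁ * (1 + L) / √(K : ℝ) := by positivity
    linarith [(hEb n le_rfl).2]
  · filter_upwards [h.ae_price_eq hD hK] with ω hω hX i
    obtain ⟨hbox, hfit⟩ := hω
    set p : ℕ → Fin N → ℝ := fun s j => P s j ω with hp
    have hbox' : ∀ s ∈ Finset.Icc 1 (n + 1), ∀ j, p s j ∈ Set.Icc M.pMin M.pMax := fun s hs j =>
      hbox s (by rwa [hT]) j
    have hinit := norm_empMoments_sub_le hD hK (p := p) fun s hs j =>
      hbox' s (Finset.mem_Icc.2 ⟨(Finset.mem_Icc.1 hs).1,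
        (Finset.mem_Icc.1 hs).2.trans (by omega)⟩) j
    have hJω : ‖empMoments K p K - z 1‖ ≤ J ω := by
      rw [hz1]
      exact hinit
    -- Here `X ω < v` is used: the exploration variances are at least 2 v, so the empirical ones are
    -- at least v.
    have hJv : ‖empMoments K p K - z 1‖ < v := by
      linarith [hA0 ω, hE0 n ω]
    have hvar : ∀ j, v ≤ coMoment p K j j / K := by
      intro j
      have h1 : |coMoment p K j j / K - explorationCov D j j| ≤ ‖empMoments K p K - z 1‖ := by
        have h2 := (norm_le_pi_norm ((empMoments K p K - z 1).2 j) j).trans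
          ((norm_le_pi_norm (empMoments K p K - z 1).2 j).trans (norm_snd_le _))
        rw [hz1] at h2 ⊢
        exact h2
      have h3 := (abs_le.1 h1).1
      linarith [hvD j]
    have hpos : ∀ j, 0 < coMoment p K j j := by
      intro j
      have h1 := (le_div_iff₀ hK').1 (hvar j)
      have : 0 < v * K := by positivity
      linarith
    -- On this event the fits are unique, so the martingale weights coincide with the posted prices.
    have hpred : ∀ s ∈ Finset.Icc 1 (n + 1), ∀ j, predictedPrice M K P Q s j ω = p s j := by
      intro s hs j
      obtain ⟨hs1, hs2⟩ := Finset.mem_Icc.1 hs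
      unfold predictedPrice
      split_ifs with hsK
      · rfl
      · have := hfit j (hpos j) (s - 1) (by omega) (by omega)
        rw [Nat.sub_add_cancel hs1] at this
        exact this.symm
    have hclose : ∀ t, K ≤ t → t ≤ n → ∀ j,
        |p (t + 1) j - M.regPosted v (empMoments K p t) j| ≤ L * E t ω := by
      intro t hKt htn j
      have hsub : ∀ s ∈ Finset.Icc 1 t, s ∈ Finset.Icc 1 (n + 1) := fun s hs =>
        Finset.mem_Icc.2 ⟨(Finset.mem_Icc.1 hs).1, (Finset.mem_Icc.1 hs).2.trans (by omega)⟩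
      have h1 : p (t + 1) j = fittedPrice M K p (fun s j => Q s j ω) t j :=
        hfit j (hpos j) t hKt (by omega)
      rw [h1]
      refine (hL K t p (fun s j => Q s j ω) (fun s j => ε s j ω) j hK hKt
        (fun s hs => hbox' s (hsub s hs))
        (fun s hs => h.demand s (by rw [hT]; exact hsub s hs) j ω)
        ((hvar j).trans (by gcongr; exact coMoment_self_mono p j hKt))).trans ?_
      refine mul_le_mul_of_nonneg_left ?_ hL0
      have h2 : ∑ s ∈ Finset.Icc 1 t, p s j * ε s j ω =
          ∑ s ∈ Finset.Icc 1 t, predictedPrice M K P Q s j ω * ε s j ω :=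
        Finset.sum_congr rfl fun s hs => by rw [hpred s (hsub s hs) j]
      rw [h2]
      exact Finset.single_le_sum (f := fun j => |∑ s ∈ Finset.Icc 1 t, ε s j ω| / (K : ℝ) +
        |∑ s ∈ Finset.Icc 1 t, predictedPrice M K P Q s j ω * ε s j ω| / (K : ℝ))
        (fun _ _ => by positivity) (Finset.mem_univ j)
    have hfin := hC₁ z hz K n p (fun t => L * E t ω) hK hKn ((div_le_iff₀ hK').2 hnS) hbox'
      (fun t => mul_nonneg hL0 (hE0 t ω)) hclose i
    refine hfin.trans ?_
    have e : (∑ t ∈ Finset.Ico K n, L * E t ω) / (K : ℝ) =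
        L * ((∑ t ∈ Finset.Ico K n, E t ω) / K) := by
      rw [← Finset.mul_sum, mul_div_assoc]
    rw [e]
    set A := (∑ t ∈ Finset.Ico K n, E t ω) / (K : ℝ) with hA
    have hA0' : 0 ≤ A := hA0 ω
    have hEn := hE0 n ω
    have hJn := hJ0 ω
    have hKi : (0 : ℝ) ≤ 1 / K := by positivity
    have hin : ‖empMoments K p K - z 1‖ + L * A + L * E n ω + 1 / K ≤
        (1 + L) * (J ω + A + E n ω + 1 / K) := by
      nlinarith [mul_nonneg hL0 hJn, mul_nonneg hL0 hKi]
    have hY : 0 ≤ J ω + A + E n ω + 1 / K := by linarith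
    calc C₁ * (‖empMoments K p K - z 1‖ + L * A + L * E n ω + 1 / K)
        ≤ C₁ * ((1 + L) * (J ω + A + E n ω + 1 / K)) := by gcongr
      _ = C₁ * (1 + L) * (J ω + A + E n ω + 1 / K) := by ring
      _ ≤ _ := by
        refine mul_le_mul_of_nonneg_right ?_ hY
        have : 0 ≤ c₀ + S * c₁ + c₁ := by positivity
        linarith

theorem mainTheorem2 {N : ℕ} (hN : 2 ≤ N) (M : Market)
    (D : Measure (Fin N → ℝ)) (hD : IsExplorationLaw M D)
    (K T : ℕ → ℕ) (τ : ℝ) (hτ : 1 ≤ τ)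
    (hK : Tendsto K atTop atTop) (hT : Tendsto T atTop atTop)
    (hKT : Tendsto (fun m => ((K m : ℝ) + (T m : ℝ)) / (K m : ℝ)) atTop (𝓝 τ))
    (Ω : ℕ → Type*) [∀ m, MeasurableSpace (Ω m)]
    (Pr : ∀ m, Measure (Ω m)) [∀ m, IsProbabilityMeasure (Pr m)]
    (P Q ε : ∀ m, ℕ → Fin N → Ω m → ℝ)
    (hP : ∀ m, IsPricingProcess M D (K m) (T m) (Pr m) (P m) (Q m) (ε m)) :
    ∃ (U : ℝ → Fin N → ℝ) (V : ℝ → Matrix (Fin N) (Fin N) ℝ),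
      IsPriceMomentsSolution M (explorationMean D) (explorationCov D) U V ∧
      (∀ U' V', IsPriceMomentsSolution M (explorationMean D) (explorationCov D) U' V' →
        ∀ s : ℝ, 1 ≤ s → U' s = U s ∧ V' s = V s) ∧
      ∀ δ : ℝ, 0 < δ →
        Tendsto
          (fun m => Pr m {ω | δ ≤ dist (fun i => P m (K m + T m) i ω)
            (postedPrice M (U τ) (V τ))})
          atTop (𝓝 0) := by
  obtain ⟨v, hv, hvD⟩ := hD.exists_variance_floor
  have hvD' : ∀ i, v ≤ explorationCov D i i := fun i => by linarith [hvD i]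
  obtain ⟨U, V, hUV⟩ := exists_isPriceMomentsSolution hN hv hD.explorationMean_mem hvD'
  refine ⟨U, V, hUV, fun U' V' h' s hs => hUV.unique hN hv hD.explorationMean_mem hvD' h' hs, ?_⟩
  have hsol := fun s (hs : (1 : ℝ) ≤ s) =>
    hUV.hasDerivWithinAt_field hN hv hD.explorationMean_mem hvD' hs
  set z : ℝ → Moments N := fun s => (U s, V s) with hz
  have hlimit : postedPrice M (U τ) (V τ) = M.regPosted v (z τ) :=
    M.postedPrice_eq_regPosted hN hv (z := z τ) (hsol τ hτ).1.1 (hsol τ hτ).1.2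
  rw [hlimit]
  -- The horizon τ + 1 eventually exceeds the rescaled times, which converge to τ.
  obtain ⟨C, hC0, hC⟩ := exists_pricing_deviation_bound hN hD hv hvD (z := z)
    (Prod.ext hUV.init_U hUV.init_V) (fun s hs => (hsol s hs).2) (S := τ + 1) (by linarith)
  obtain ⟨L, hL0, hL⟩ := M.exists_regPosted_lipschitz hN hv
  have hKr : Tendsto (fun m => (K m : ℝ)) atTop atTop := tendsto_natCast_atTop_atTop.comp hK
  have hKinv : Tendsto (fun m => 1 / (K m : ℝ)) atTop (𝓝 0) :=
    hKr.const_div_atTop 1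
  -- The last price is set from the data of the first n = K + T - 1 periods, so the relevant ODE
  -- time is n / K; it has the same limit τ.
  set n : ℕ → ℕ := fun m => K m + T m - 1 with hn
  have hlarge : ∀ᶠ m in atTop, 1 ≤ K m ∧ 1 ≤ T m :=
    (hK.eventually_ge_atTop 1).and (hT.eventually_ge_atTop 1)
  have hratio : Tendsto (fun m => (n m : ℝ) / K m) atTop (𝓝 τ) := by
    have h1 := hKT.sub hKinv
    rw [sub_zero] at h1
    refine h1.congr' ?_
    filter_upwards [hlarge] with m hm
    have : (n m : ℝ) = K m + T m - 1 := by
      simp only [hn]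
      rw [Nat.cast_sub (by omega)]
      push_cast
      ring
    rw [this]
    ring
  have hzn : Tendsto (fun m => L * ‖z (n m / K m) - z τ‖) atTop (𝓝 0) := by
    have hcont : ContinuousWithinAt z (Set.Ici 1) τ := (hsol τ hτ).2.continuousWithinAt
    have h1 : Tendsto (fun m => (n m : ℝ) / K m) atTop (𝓝[Set.Ici 1] τ) := by
      refine tendsto_nhdsWithin_iff.2 ⟨hratio, ?_⟩
      filter_upwards [hlarge] with m hm
      have hK' : (0 : ℝ) < K m := by exact_mod_cast hm.1
      have : K m ≤ n m := by simp only [hn]; omega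
      rw [Set.mem_Ici, le_div_iff₀ hK', one_mul]
      exact_mod_cast this
    have h2 := (tendsto_iff_norm_sub_tendsto_zero.1 (hcont.tendsto.comp h1)).const_mul L
    simpa using h2
  intro δ hδ
  -- Below v the pathwise bound is valid, and the second term gives C X ≤ δ / 3. The other two
  -- thirds of δ cover C / K and the move from n / K to τ.
  set ρ := min v (δ / (3 * (C + 1))) with hρ
  have hρ0 : 0 < ρ := lt_min hv (by positivity)
  have hbound : Tendsto (fun m => ENNReal.ofReal (C / √(K m) / ρ)) atTop (𝓝 0) := by
    have h1 : Tendsto (fun m => C / √(K m : ℝ) / ρ) atTop (𝓝 0) := by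
      have h2 : Tendsto (fun m => √(K m : ℝ)) atTop atTop := Real.tendsto_sqrt_atTop.comp hKr
      simpa using (h2.const_div_atTop C).div_const ρ
    simpa using ENNReal.tendsto_ofReal h1
  refine tendsto_of_tendsto_of_tendsto_of_le_of_le' tendsto_const_nhds hbound
    (Eventually.of_forall fun _ => zero_le) ?_
  have hev1 : ∀ᶠ m in atTop, (n m : ℝ) / K m ≤ τ + 1 :=
    hratio.eventually_le_const (by linarith)
  have hev2 : ∀ᶠ m in atTop, C * (1 / (K m : ℝ)) < δ / 3 := by
    have := hKinv.const_mul C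
    rw [mul_zero] at this
    exact this.eventually_lt_const (by positivity)
  have hev3 : ∀ᶠ m in atTop, L * ‖z (n m / K m) - z τ‖ < δ / 3 :=
    hzn.eventually_lt_const (by positivity)
  filter_upwards [hlarge, hev1, hev2, hev3] with m hm h1 h2 h3
  have hK' : (0 : ℝ) < K m := by exact_mod_cast hm.1
  have hnT : K m + T m = n m + 1 := by simp only [hn]; omega
  obtain ⟨X, hXi, hX0, hXb, hXd⟩ := hC (Pr m) (P m) (Q m) (ε m) (K m) (n m) hm.1
    (by simp only [hn]; omega) ((div_le_iff₀ hK').1 h1) (T m) hnT (hP m)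
  have hsubset : Pr m {ω | δ ≤ dist (fun i => P m (K m + T m) i ω) (M.regPosted v (z τ))} ≤
      Pr m {ω | ρ ≤ X ω} := by
    refine measure_mono_ae ?_
    filter_upwards [hXd] with ω hω hδω
    by_contra hlt
    have hXρ : X ω < ρ := not_le.1 hlt
    have hdist : dist (fun i => P m (K m + T m) i ω) (M.regPosted v (z τ)) < δ := by
      rw [dist_pi_lt_iff hδ]
      intro i
      have h4 := hω (hXρ.trans_le (min_le_left _ _)) i
      have h5 := hL (z (n m / K m)) (z τ) i
      have h6 := abs_sub_le (P m (n m + 1) i ω) (M.regPosted v (z (n m / K m)) i)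
        (M.regPosted v (z τ) i)
      have h7 : C * X ω ≤ δ / 3 := by
        have h8 : X ω ≤ δ / (3 * (C + 1)) := (hXρ.trans_le (min_le_right _ _)).le
        calc C * X ω ≤ (C + 1) * (δ / (3 * (C + 1))) :=
              mul_le_mul (by linarith) h8 (hX0 ω) (by linarith)
          _ = δ / 3 := by field_simp
      rw [hnT, Real.dist_eq]
      linarith
    exact absurd hδω (not_le.2 hdist)
  refine hsubset.trans ?_
  have hmarkov := mul_meas_ge_le_integral_of_nonneg (ae_of_all _ hX0) hXi ρ
  have hreal : (Pr m).real {ω | ρ ≤ X ω} ≤ C / √(K m) / ρ := by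
    rw [le_div_iff₀ hρ0]
    linarith
  rw [← ofReal_measureReal]
  exact ENNReal.ofReal_le_ofReal hreal

end
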